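/- **Setting.** A *symmetric-key encryption scheme* $\Pi=(\mathsf{KeyGen},\mathsf{Enc},\mathsf{Dec})$ consists, for each security parameter $n$, of finite spaces of keys, messages and ciphertexts $\mathcal K_n=\{0,1\}^{\kappa(n)}$, $\mathcal M_n=\{0,1\}^{\ell(n)}$, $\mathcal C_n=\{0,1\}^{\lambda(n)}$ and of polynomial-time algorithms: a probabilistic $\mathsf{KeyGen}(1^n)\in\mathcal K_n$, a probabilistic $\mathsf{Enc}_k(m)=\mathsf{Enc}_k(m;r)\in\mathcal C_n$ with a uniformly random tape $r\in\{0,1\}^{\rho(n)}$, and a deterministic $\mathsf{Dec}_k(c)\in\mathcal M_n$, such that $\mathsf{Dec}_k(\mathsf{Enc}_k(m;r))=m$ for all keys $k$ that $\mathsf{KeyGen}(1^n)$ can output, all $m\in\mathcal M_n$ and all $r$. All lengths, including those of the random tapes, are computable in time polynomial in $n$ in unary. The *quantum oracles* are $\mathsf{Enc}_k:|m\rangle|c\rangle\mapsto|m\rangle|c\oplus\mathsf{Enc}_k(m;r)\rangle$, with a fresh uniformly random $r$ at each query (the same $r$ for the whole superposition), and $\mathsf{Dec}_k:|c\rangle|s\rangle\mapsto|c\rangle|s\oplus\mathsf{Dec}_k(c)\rangle$.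 A *QPT adversary* is a pair of programs, one for each phase of a game below, the entire classical and quantum memory being kept between the phases. The programs are uniform (one fixed program for all $n$), have classical control, coins, the gates $X$, $H$, $T$, CNOT, Toffoli, computational basis measurements and oracle queries at unit cost, and run, for any oracles and any content of the memory, in a number of steps polynomial in the length of their classical memory content. At the start of each phase the adversary is given $1^n,1^{\ell(n)},1^{\lambda(n)}$. A function $\mathrm{negl}:\mathbb N\to\mathbb R$ is *negligible* if for every positive polynomial $p$ there is $N$ with $\mathrm{negl}(n)<1/p(n)$ for all $n>N$. **IND-QCCA1.** In $\mathsf{IndGame}$, a key $k\leftarrow\mathsf{KeyGen}(1^n)$ and a uniformly random bit $b$ are generated; $\mathcal A$, with oracles $\mathsf{Enc}_k$ and $\mathsf{Dec}_k$, outputs messages $(m_0,m_1)\in\mathcal M_n^2$; then $\mathcal A$ receives $\mathsf{Enc}_k(m_b)$ and, with the oracle $\mathsf{Enc}_k$ only, outputs a bit $b'$; it wins if $b'=b$. $\Pi$ is *IND-QCCA1-secure* if for every QPT $\mathcal A$ there is a negligible function with $\Pr[\mathcal A\text{ wins }\mathsf{IndGame}]\le\frac12+\mathrm{negl}(n)$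 for all $n$. **SEM-QCCA1.** In $\mathsf{SemGame}$ with bit $b\in\{0,1\}$, a key $k\leftarrow\mathsf{KeyGen}(1^n)$ is generated; $\mathcal A$, with oracles $\mathsf{Enc}_k$ and $\mathsf{Dec}_k$, outputs a challenge template $(\mathsf{Samp},h,f)$ of classical Boolean circuits, where $\mathsf{Samp}$ maps uniformly random bits to a message in $\mathcal M_n$ and $h,f$ map messages to bit strings; a plaintext $m\leftarrow\mathsf{Samp}$ is drawn; $\mathcal A$ receives $1^{|m|}$, $h(m)$ and, only if $b=1$, a ciphertext $\mathsf{Enc}_k(m)$; with the oracle $\mathsf{Enc}_k$ only, it outputs a string $s$, and it wins if $s=f(m)$. $\Pi$ is *SEM-QCCA1-secure* if for every QPT $\mathcal A$ there is a QPT $\mathcal S$ such that, for every $n$, the challenge templates output by $\mathcal A$ and $\mathcal S$ are identically distributed, and there is a negligible function such that, for all $n$, $$\bigl|\Pr[\mathcal A\text{ wins }\mathsf{SemGame}\text{ with }b=1]-\Pr[\mathcal S\text{ wins }\mathsf{SemGame}\text{ with }b=0]\bigr|\le\mathrm{negl}(n).$$ **Theorem.** Let $\Pi$ be a symmetric-key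 encryption scheme. Then $\Pi$ is IND-QCCA1-secure if and only if $\Pi$ is SEM-QCCA1-secure. -/

import Mathlib

open scoped NNReal ENNReal

noncomputable section

namespace QCrypt

/-! ### Bit strings and quantum memory -/

/-- Bit strings of length `n`. -/
abbrev Bits (n : ℕ) : Type := Fin n → Bool

/-- Reads a register as an `n`-bit string (truncating, or padding with zeros). -/
def readBits (n : ℕ) (l : List Bool) : Bits n := fun i => l.getD i false

/-- The unary string `1^n`. -/
def unary (n : ℕ) : List Bool := List.replicate n true

/-- A (not necessarily normalized) pure state of a memory of qubits numbered `0, 1, 2, …`.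
The basis vector `|S⟩` is the one in which exactly the qubits in the finite set `S` are `1`. -/
abbrev QState : Type := Finset ℕ →₀ ℂ

/-- The all-zero state `|00…0⟩`. -/
def vacuum : QState := Finsupp.single ∅ 1

/-- Flips qubit `i` in a basis state. -/
def flipBit (i : ℕ) (S : Finset ℕ) : Finset ℕ := symmDiff S {i}

/-- `X` on qubit `i`. -/
def gateX (i : ℕ) (ψ : QState) : QState := ψ.mapDomain (flipBit i)

/-- The Hadamard gate on qubit `i`. -/
def gateH (i : ℕ) (ψ : QState) : QState :=
  ψ.sum fun S a =>
    Finsupp.single (S.erase i) (a / (Real.sqrt 2 : ℂ)) +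
      Finsupp.single (insert i S) ((if i ∈ S then -a else a) / (Real.sqrt 2 : ℂ))

/-- The phase-shift gate by the angle `π / 4` on qubit `i`. -/
def gateT (i : ℕ) (ψ : QState) : QState :=
  ψ.sum fun S a =>
    Finsupp.single S (if i ∈ S then Complex.exp (Complex.I * (Real.pi / 4 : ℝ)) * a else a)

/-- `CNOT` with control `i` and target `j` (no operation if `i = j`). -/
def gateCNOT (i j : ℕ) (ψ : QState) : QState :=
  ψ.mapDomain fun S => if i ∈ S ∧ i ≠ j then flipBit j S else S

/-- The Toffoli gate with controls `i, j` and target `k`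
(no operation if the target is one of the controls). -/
def gateToffoli (i j k : ℕ) (ψ : QState) : QState :=
  ψ.mapDomain fun S => if (i ∈ S ∧ j ∈ S) ∧ i ≠ k ∧ j ≠ k then flipBit k S else S

/-- The oracle unitary `|x⟩|y⟩ ↦ |x⟩|y ⊕ f x⟩`, where `x` is held by the qubits
`base, …, base + a - 1` and `y` by the `b` qubits that follow. -/
def oracleUnitary {a b : ℕ} (f : Bits a → Bits b) (base : ℕ) (ψ : QState) : QState :=
  ψ.mapDomain fun S =>
    symmDiff S (Finset.image (fun j : Fin b => base + a + (j : ℕ))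
      (Finset.univ.filter fun j : Fin b =>
        f (fun i : Fin a => decide (base + (i : ℕ) ∈ S)) j = true))

/-- The (unnormalized) state after qubit `i` has been measured with outcome `o`. -/
def project (i : ℕ) (o : Bool) (ψ : QState) : QState := ψ.filter fun S => decide (i ∈ S) = o

/-- The squared norm of a state. -/
def normSq (ψ : QState) : ℝ≥0 := ψ.sum fun _ a => ‖a‖₊ ^ 2

/-- The distribution on bits that gives `true` the probability `p`. -/
def bernoulli (p : ℝ≥0∞) (hp : p ≤ 1) : PMF Bool :=
  PMF.ofFintype (fun o => if o then p else 1 - p) (by simp [add_tsub_cancel_of_le hp])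

/-- The outcome of a computational basis measurement of qubit `i`: the outcome `1` has probability
`‖P₁ψ‖² / (‖P₀ψ‖² + ‖P₁ψ‖²)`. -/
def measureDist (i : ℕ) (ψ : QState) : PMF Bool :=
  bernoulli
    ((normSq (project i true ψ) /
      (normSq (project i false ψ) + normSq (project i true ψ)) : ℝ≥0) : ℝ≥0∞)
    (by
      rw [ENNReal.coe_le_one_iff]
      exact div_le_one_of_le₀ le_add_self zero_le)

/-! ### Quantum oracle programs -/

/-- The two oracles that a program may be given. -/
inductive OracleName : Type
  | enc
  | dec

/-- A quantum oracle with `inLen` input and `outLen` output qubits. At each query a function is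
drawn afresh from `fn` and applied to the whole superposition. -/
structure QOracle where
  inLen : ℕ
  outLen : ℕ
  fn : PMF (Bits inLen → Bits outLen)

/-- The oracle without any input or output, used where no oracle is to be given. -/
def noOracle : QOracle := ⟨0, 0, PMF.pure id⟩

/-- Programs of a machine with finitely many classical registers, each holding a stack of bits
(the head of the list is the top), and a memory of qubits. The qubit that an instruction acts on is
given by the length of the content of a classical register (an address in unary). -/
inductive Prog : Type
  /-- do nothing -/
  | skip
  /-- push the bit `b` on register `r` -/
  | push (r : ℕ) (b : Bool)
  /-- remove the top of register `r` -/
  | pop (r : ℕ)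
  /-- replace the content of register `dst` by that of `src` -/
  | copy (dst src : ℕ)
  /-- sequential composition -/
  | seq (P Q : Prog)
  /-- continue with `E`, `F` or `T` if register `r` is empty, has top `0` or has top `1` -/
  | branch (r : ℕ) (E F T : Prog)
  /-- run `P` as many times as register `r` has bits at the beginning -/
  | loop (r : ℕ) (P : Prog)
  /-- push a uniformly random bit on register `r` -/
  | coin (r : ℕ)
  /-- the gate `X` -/
  | X (q : ℕ)
  /-- the Hadamard gate -/
  | H (q : ℕ)
  /-- the `π / 4` phase-shift gate -/
  | T (q : ℕ)
  /-- the `CNOT` gate -/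
  | CNOT (q₁ q₂ : ℕ)
  /-- the Toffoli gate -/
  | Toffoli (q₁ q₂ q₃ : ℕ)
  /-- measure a qubit in the computational basis and push the outcome on register `r` -/
  | measure (q r : ℕ)
  /-- query an oracle on consecutive qubits, beginning with qubit `q` -/
  | query (o : OracleName) (q : ℕ)

/-- The content of the memory: classical registers and qubits. -/
structure Config where
  reg : ℕ → List Bool
  qst : QState

/-- Overwrites register `r` by `l`. -/
def Config.set (c : Config) (r : ℕ) (l : List Bool) : Config :=
  { c with reg := Function.update c.reg r l }

/-- The qubit addressed by register `r`. -/
def Config.addr (c : Config) (r : ℕ) : ℕ := (c.reg r).length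

/-- Applies a quantum operation to the qubits. -/
def Config.mapQ (c : Config) (U : QState → QState) : Config := { c with qst := U c.qst }

/-- Runs `step` from `c`, `k` times in a row. -/
def iterate (step : Config → PMF Config) : ℕ → Config → PMF Config
  | 0, c => PMF.pure c
  | k + 1, c => (step c).bind (iterate step k)

/-- The distribution of the final content of the memory. -/
def exec (env : OracleName → QOracle) : Prog → Config → PMF Config
  | .skip, c => PMF.pure c
  | .push r b, c => PMF.pure (c.set r (b :: c.reg r))
  | .pop r, c => PMF.pure (c.set r (c.reg r).tail)
  | .copy dst src, c => PMF.pure (c.set dst (c.reg src))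
  | .seq P Q, c => (exec env P c).bind (exec env Q)
  | .branch r E F T, c =>
      match c.reg r with
      | [] => exec env E c
      | false :: _ => exec env F c
      | true :: _ => exec env T c
  | .loop r P, c => iterate (exec env P) (c.reg r).length c
  | .coin r, c => (PMF.uniformOfFintype Bool).map fun b => c.set r (b :: c.reg r)
  | .X q, c => PMF.pure (c.mapQ (gateX (c.addr q)))
  | .H q, c => PMF.pure (c.mapQ (gateH (c.addr q)))
  | .T q, c => PMF.pure (c.mapQ (gateT (c.addr q)))
  | .CNOT q₁ q₂, c => PMF.pure (c.mapQ (gateCNOT (c.addr q₁) (c.addr q₂)))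
  | .Toffoli q₁ q₂ q₃, c =>
      PMF.pure (c.mapQ (gateToffoli (c.addr q₁) (c.addr q₂) (c.addr q₃)))
  | .measure q r, c =>
      (measureDist (c.addr q) c.qst).map fun o =>
        (c.mapQ (project (c.addr q) o)).set r (o :: c.reg r)
  | .query o q, c => (env o).fn.map fun f => c.mapQ (oracleUnitary f (c.addr q))

/-- The worst-case number of steps of `k` runs of a program whose outcome distribution is `step` and
whose worst-case number of steps is `cost`. -/
def iterateTime (step : Config → PMF Config) (cost : Config → ℕ∞) : ℕ → Config → ℕ∞
  | 0, _ => 0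
  | k + 1, c => cost c + ⨆ c' ∈ (step c).support, iterateTime step cost k c'

/-- The number of steps of a program in the worst case over all outcomes of its random choices,
measurements and oracle answers. Every instruction, and every oracle query, costs one step. -/
def time (env : OracleName → QOracle) : Prog → Config → ℕ∞
  | .seq P Q, c => time env P c + ⨆ c' ∈ (exec env P c).support, time env Q c'
  | .branch r E F T, c =>
      1 + match c.reg r with
        | [] => time env E c
        | false :: _ => time env F c
        | true :: _ => time env T c
  | .loop r P, c => 1 + iterateTime (exec env P) (time env P) (c.reg r).length c
  | _, _ => 1

/-- A program is efficient if its running time is bounded by a polynomial in the length of its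
classical input, for all contents of the memory and with all oracles. -/
def IsPolyTime (P : Prog) : Prop :=
  ∃ p : Polynomial ℕ, ∀ (env : OracleName → QOracle) (N : ℕ) (c : Config),
    (∀ r, (c.reg r).length ≤ N) → time env P c ≤ (p.eval N : ℕ)

/-- Programs without coins, quantum operations and oracle queries. -/
def IsDeterministic : Prog → Prop
  | .skip | .push _ _ | .pop _ | .copy _ _ => True
  | .seq P Q => IsDeterministic P ∧ IsDeterministic Q
  | .branch _ E F T => IsDeterministic E ∧ IsDeterministic F ∧ IsDeterministic T
  | .loop _ P => IsDeterministic P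
  | _ => False

/-- The memory with inputs `ins` in the registers `0, 1, …`, and all else empty. -/
def inputConfig (ins : List (List Bool)) : Config := ⟨fun r => ins.getD r [], vacuum⟩

/-- A function, given by its graph `i ↦ (ins i, out i)`, is computed in classical deterministic
polynomial time, with the output in register `0`. -/
def PolyTimeComputable {ι : Type} (ins : ι → List (List Bool)) (out : ι → List Bool) : Prop :=
  ∃ P : Prog, IsDeterministic P ∧ IsPolyTime P ∧
    ∀ (i : ι) (env : OracleName → QOracle), ∀ c ∈ (exec env P (inputConfig (ins i))).support,
      c.reg 0 = out i

/-- A length function that is polynomial-time computable in unary (hence polynomially bounded). -/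
def PolyTimeLength (ℓ : ℕ → ℕ) : Prop :=
  PolyTimeComputable (fun n : ℕ => [unary n]) (fun n => unary (ℓ n))

/-! ### Symmetric-key encryption schemes -/

/-- A symmetric-key encryption scheme: for each security parameter `n`, finite spaces of keys,
messages and ciphertexts, a probabilistic key generation, a probabilistic encryption and a
deterministic decryption, all of polynomial time, with correct decryption. Probabilistic algorithms
take the content of a uniformly random tape as their last argument. -/
structure SKES where
  keyLen : ℕ → ℕ
  msgLen : ℕ → ℕ
  ctLen : ℕ → ℕ
  keyTape : ℕ → ℕ
  encTape : ℕ → ℕ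
  keyGen : (n : ℕ) → Bits (keyTape n) → Bits (keyLen n)
  enc : (n : ℕ) → Bits (keyLen n) → Bits (msgLen n) → Bits (encTape n) → Bits (ctLen n)
  dec : (n : ℕ) → Bits (keyLen n) → Bits (ctLen n) → Bits (msgLen n)
  keyLen_poly : PolyTimeLength keyLen
  msgLen_poly : PolyTimeLength msgLen
  ctLen_poly : PolyTimeLength ctLen
  keyTape_poly : PolyTimeLength keyTape
  encTape_poly : PolyTimeLength encTape
  keyGen_poly : PolyTimeComputable
    (fun i : (n : ℕ) × Bits (keyTape n) => [unary i.1, List.ofFn i.2])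
    (fun i => List.ofFn (keyGen i.1 i.2))
  enc_poly : PolyTimeComputable
    (fun i : (n : ℕ) × Bits (keyLen n) × Bits (msgLen n) × Bits (encTape n) =>
      [unary i.1, List.ofFn i.2.1, List.ofFn i.2.2.1, List.ofFn i.2.2.2])
    (fun i => List.ofFn (enc i.1 i.2.1 i.2.2.1 i.2.2.2))
  dec_poly : PolyTimeComputable
    (fun i : (n : ℕ) × Bits (keyLen n) × Bits (ctLen n) =>
      [unary i.1, List.ofFn i.2.1, List.ofFn i.2.2])
    (fun i => List.ofFn (dec i.1 i.2.1 i.2.2))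
  correct : ∀ (n : ℕ) (s : Bits (keyTape n)) (m : Bits (msgLen n)) (r : Bits (encTape n)),
    dec n (keyGen n s) (enc n (keyGen n s) m r) = m

namespace SKES

variable (Sch : SKES) (n : ℕ) (k : Bits (Sch.keyLen n))

/-- The distribution of `k ← KeyGen(1^n)`. -/
def keyDist : PMF (Bits (Sch.keyLen n)) :=
  (PMF.uniformOfFintype (Bits (Sch.keyTape n))).map (Sch.keyGen n)

/-- The distribution of a ciphertext `Enc_k(m)`. -/
def encDist (m : Bits (Sch.msgLen n)) : PMF (Bits (Sch.ctLen n)) :=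
  (PMF.uniformOfFintype (Bits (Sch.encTape n))).map (Sch.enc n k m)

/-- The quantum encryption oracle `|m⟩|c⟩ ↦ |m⟩|c ⊕ Enc_k(m; r)⟩`, with fresh `r` at each query. -/
def encOracle : QOracle where
  inLen := Sch.msgLen n
  outLen := Sch.ctLen n
  fn := (PMF.uniformOfFintype (Bits (Sch.encTape n))).map fun r m => Sch.enc n k m r

/-- The quantum decryption oracle `|c⟩|m⟩ ↦ |c⟩|m ⊕ Dec_k(c)⟩`. -/
def decOracle : QOracle where
  inLen := Sch.ctLen n
  outLen := Sch.msgLen n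
  fn := PMF.pure (Sch.dec n k)

/-- The oracles before the challenge: encryption and decryption. -/
def preOracles : OracleName → QOracle
  | .enc => Sch.encOracle n k
  | .dec => Sch.decOracle n k

/-- The oracles after the challenge: encryption only. -/
def postOracles : OracleName → QOracle
  | .enc => Sch.encOracle n k
  | .dec => noOracle

/-- Writes `1^n` and the lengths (in unary) of messages and ciphertexts to registers `0, 1, 2`. -/
def writeParams (c : Config) : Config :=
  ((c.set 0 (unary n)).set 1 (unary (Sch.msgLen n))).set 2 (unary (Sch.ctLen n))

/-- The initial content of the adversary's memory. -/
def start : Config := Sch.writeParams n (inputConfig [])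

end SKES

/-! ### Security games -/

/-- A quantum polynomial-time adversary: a program for each of the two phases. The entire memory,
including the qubits, is kept from the first phase to the second. -/
structure QPT where
  pre : Prog
  post : Prog
  pre_poly : IsPolyTime pre
  post_poly : IsPolyTime post

/-- `μ n < 1 / p n` for all large `n`, for every (positive) polynomial `p`. -/
def Negligible (μ : ℕ → ℝ) : Prop :=
  ∀ p : Polynomial ℝ, (∀ n : ℕ, 0 < p.eval (n : ℝ)) →
    ∃ N : ℕ, ∀ n : ℕ, N < n → μ n < 1 / p.eval (n : ℝ)

/-- The indistinguishability game; the result is `true` if the adversary wins. The challenge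
messages are output in registers `3` and `4`, the challenge ciphertext is input in register `4`, and
the guess is output as the top of register `5`. -/
def indGame (Sch : SKES) (A : QPT) (n : ℕ) : PMF Bool :=
  (Sch.keyDist n).bind fun k =>
  (PMF.uniformOfFintype Bool).bind fun b =>
  (exec (Sch.preOracles n k) A.pre (Sch.start n)).bind fun c₁ =>
  (Sch.encDist n k (readBits (Sch.msgLen n) (c₁.reg (if b then 4 else 3)))).bind fun ct =>
  (exec (Sch.postOracles n k) A.post
    ((Sch.writeParams n c₁).set 4 (List.ofFn ct))).map fun c₂ =>
  (c₂.reg 5).headD false == b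

/-- Indistinguishability under non-adaptive quantum chosen-ciphertext attack. -/
def INDQCCA1 (Sch : SKES) : Prop :=
  ∀ A : QPT, ∃ negl : ℕ → ℝ, Negligible negl ∧
    ∀ n : ℕ, (indGame Sch A n true).toReal ≤ 1 / 2 + negl n

/-- A Boolean circuit of NAND gates. The wires are listed with the latest one first, initially the
inputs; a gate `(i, j)` puts the NAND of wires number `i` and `j` of the current list in front. In
the end the wires with the numbers `outs` are output. Wires that do not exist carry `0`. -/
structure Circuit where
  gates : List (ℕ × ℕ)
  outs : List ℕ

/-- The output of a circuit. -/
def Circuit.eval (C : Circuit) (x : List Bool) : List Bool :=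
  let wires := C.gates.foldl (fun (w : List Bool) (g : ℕ × ℕ) =>
    (!(w.getD g.1 false && w.getD g.2 false)) :: w) x
  C.outs.map fun i => wires.getD i false

/-- Decodes `1^a 0 1^b 0 …` to the list `a, b, …` (with `acc` more ones in front). -/
def unaryBlocks : ℕ → List Bool → List ℕ
  | _, [] => []
  | acc, true :: l => unaryBlocks (acc + 1) l
  | acc, false :: l => acc :: unaryBlocks 0 l

/-- Groups a list into consecutive pairs. -/
def pairUp : List ℕ → List (ℕ × ℕ)
  | a :: b :: l => (a, b) :: pairUp l
  | _ => []

/-- The circuit encoded by two bit strings, one for the gates and one for the output wires. -/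
def decodeCircuit (g o : List Bool) : Circuit := ⟨pairUp (unaryBlocks 0 g), unaryBlocks 0 o⟩

/-- A challenge template `(Samp, h, f)` of classical circuits, where `Samp` takes `coins` uniformly
random bits as its input. -/
structure Template where
  coins : ℕ
  samp : Circuit
  h : Circuit
  f : Circuit

/-- The plaintext distribution given by `Samp`. -/
def Template.msgDist (τ : Template) (ℓ : ℕ) : PMF (Bits ℓ) :=
  (PMF.uniformOfFintype (Bits τ.coins)).map fun r =>
    readBits ℓ (τ.samp.eval (List.ofFn r))

/-- The challenge template that is output in registers `3, …, 9`. -/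
def readTemplate (c : Config) : Template where
  coins := (c.reg 3).length
  samp := decodeCircuit (c.reg 4) (c.reg 5)
  h := decodeCircuit (c.reg 6) (c.reg 7)
  f := decodeCircuit (c.reg 8) (c.reg 9)

/-- The distribution of the challenge template output by an adversary. -/
def templateDist (Sch : SKES) (A : QPT) (n : ℕ) : PMF Template :=
  (Sch.keyDist n).bind fun k =>
  (exec (Sch.preOracles n k) A.pre (Sch.start n)).map readTemplate

/-- The semantic security game for a given value of the bit `b`; the result is `true` if the
adversary wins. In the second phase the adversary is given `1^n`, `1^{|m|}` and `h(m)` (in register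
`3`), and, only if `b = 1`, a ciphertext `Enc_k(m)` in register `4`. It outputs a string in
register `5`. -/
def semGame (Sch : SKES) (A : QPT) (b : Bool) (n : ℕ) : PMF Bool :=
  (Sch.keyDist n).bind fun k =>
  (exec (Sch.preOracles n k) A.pre (Sch.start n)).bind fun c₁ =>
  ((readTemplate c₁).msgDist (Sch.msgLen n)).bind fun m =>
  (Sch.encDist n k m).bind fun ct =>
  (exec (Sch.postOracles n k) A.post
    (((Sch.writeParams n c₁).set 3 ((readTemplate c₁).h.eval (List.ofFn m))).set 4
      (if b then List.ofFn ct else []))).map fun c₂ =>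
  c₂.reg 5 == (readTemplate c₁).f.eval (List.ofFn m)

/-- Semantic security under non-adaptive quantum chosen-ciphertext attack: every adversary that
receives the ciphertext is matched by a simulator that does not. -/
def SEMQCCA1 (Sch : SKES) : Prop :=
  ∀ A : QPT, ∃ S : QPT, (∀ n : ℕ, templateDist Sch A n = templateDist Sch S n) ∧
    ∃ negl : ℕ → ℝ, Negligible negl ∧
      ∀ n : ℕ, |(semGame Sch A true n true).toReal - (semGame Sch S false n true).toReal| ≤ negl n

end QCrypt

end

noncomputable section

namespace QCrypt

/-! Both directions are reductions that use the adversary as a black box, inside the concrete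
machine model.

From indistinguishability to semantic security, the simulator gives the adversary an encryption of
the zero message in place of one of `m`. It produces that ciphertext before the adversary starts,
while all qubits are still known to be zero: one query, followed by measuring and resetting the
answer, leaves the qubits in the vacuum state. The adversary's first phase is therefore undisturbed
and the template has exactly the required distribution. Given the key, this ciphertext is
independent of the template and of `m`, so it may as well be drawn after them; thus the simulated
game is `semHybrid` with the zero message (`semGame_zeroSimulator`), and the real game is
`semHybrid` with `id`. A distinguisher between the two samples `m` itself by evaluating `Samp`,
submits the zero message and `m` as challenges, and tests whether the output is `f(m)`
(`indGame_semDistinguisher`). As the definition of indistinguishability bounds the advantage from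
one side only, the test is used together with its negation to bound the absolute value.

From semantic security to indistinguishability, the template samples one of the challenge messages
`m₀`, `m₁` by a coin, `h` reveals nothing, and `f` is injective (it reverses the message). The
second phase outputs the message that the distinguisher guesses. A simulator sees nothing that
depends on `m`, so it wins with probability at most the expected largest point mass of `f(m)`
(`semGame_false_le`). This quantity depends on the template distribution alone, which the simulator
shares with the adversary, so it is at most `U`, the expectation of `1` if `m₀ = m₁` and of `1/2`
otherwise (`expect_guessProb_indAdversary_le`). Conditioning on whether `m₀ = m₁` gives the exact
identity Pr[semantic win] + 1/2 = Pr[indistinguishability win] + `U`, so the advantage is bounded by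
the same negligible function.

What remains is that the reductions are programs of the model. Polynomial time is closed under
composition because a program lengthens registers by at most its running time (`IsPolyTime.seq`); a
program cannot see or change registers beyond those it mentions (`exec_of_agree`), so a reduction
can keep its own data there; and circuits given by their codes can be evaluated in polynomial time
(`run_evalCircuit`). -/

/-! ### Running time -/

/-- All registers have length at most `M`. -/
def LengthsLE (M : ℕ∞) (c : Config) : Prop := ∀ r, ((c.reg r).length : ℕ∞) ≤ M

theorem LengthsLE.mono {M M' : ℕ∞} {c : Config} (h : LengthsLE M c) (hM : M ≤ M') :
    LengthsLE M' c := fun r => (h r).trans hM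

theorem LengthsLE.set {M : ℕ∞} {c : Config} (h : LengthsLE M c) (r : ℕ) {l : List Bool}
    (hl : (l.length : ℕ∞) ≤ M) : LengthsLE M (c.set r l) := by
  intro s
  by_cases hs : s = r
  · subst hs; simpa [Config.set] using hl
  · simpa [Config.set, hs] using h s

theorem LengthsLE.push {M : ℕ∞} {c : Config} (h : LengthsLE M c) (r : ℕ) (b : Bool) :
    LengthsLE (M + 1) (c.set r (b :: c.reg r)) :=
  (h.mono le_self_add).set r (by simpa using h r)

theorem lengthsLE_iterate {step : Config → PMF Config} {cost : Config → ℕ∞}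
    (hs : ∀ (M : ℕ∞) (c : Config), LengthsLE M c → ∀ c' ∈ (step c).support,
      LengthsLE (M + cost c) c') (k : ℕ) :
    ∀ (M : ℕ∞) (c : Config), LengthsLE M c → ∀ c' ∈ (iterate step k c).support,
      LengthsLE (M + iterateTime step cost k c) c' := by
  induction k with
  | zero =>
    intro M c h c' hc'
    rw [iterate, PMF.mem_support_pure_iff] at hc'
    subst hc'
    exact h.mono le_self_add
  | succ k ih =>
    intro M c h c' hc'
    rw [iterate, PMF.mem_support_bind_iff] at hc'
    obtain ⟨d, hd, hc'⟩ := hc'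
    refine (ih _ _ (hs M c h d hd) c' hc').mono ?_
    rw [iterateTime, add_assoc]
    gcongr
    exact le_iSup₂ (f := fun c' (_ : c' ∈ (step c).support) => iterateTime step cost k c') d hd

/-- A single step adds at most one bit to a register. Copying may lengthen its target by more, but
never beyond the longest register present, which is why the bound concerns the maximum over all
registers. -/
theorem lengthsLE_exec (env : OracleName → QOracle) (P : Prog) :
    ∀ (M : ℕ∞) (c : Config), LengthsLE M c → ∀ c' ∈ (exec env P c).support,
      LengthsLE (M + time env P c) c' := by
  induction P with
  | push r b =>
    intro M c h c' hc'
    rw [exec, PMF.mem_support_pure_iff] at hc'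
    subst hc'
    exact h.push r b
  | pop r =>
    intro M c h c' hc'
    rw [exec, PMF.mem_support_pure_iff] at hc'
    subst hc'
    refine (h.set r ?_).mono le_self_add
    refine le_trans ?_ (h r)
    simp
  | copy d s =>
    intro M c h c' hc'
    rw [exec, PMF.mem_support_pure_iff] at hc'
    subst hc'
    exact (h.set d (h s)).mono le_self_add
  | seq P Q ihP ihQ =>
    intro M c h c' hc'
    rw [exec, PMF.mem_support_bind_iff] at hc'
    obtain ⟨d, hd, hc'⟩ := hc'
    refine (ihQ _ _ (ihP M c h d hd) c' hc').mono ?_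
    rw [time, add_assoc]
    gcongr
    exact le_iSup₂ (f := fun c' (_ : c' ∈ (exec env P c).support) => time env Q c') d hd
  | branch r E F T ihE ihF ihT =>
    intro M c h c' hc'
    rw [exec] at hc'
    rw [time]
    split at hc'
    · exact (ihE M c h c' hc').mono (by gcongr; exact le_add_self)
    · exact (ihF M c h c' hc').mono (by gcongr; exact le_add_self)
    · exact (ihT M c h c' hc').mono (by gcongr; exact le_add_self)
  | loop r P ih =>
    intro M c h c' hc'
    rw [exec] at hc'
    rw [time]
    exact (lengthsLE_iterate ih _ M c h c' hc').mono (by gcongr; exact le_add_self)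
  | coin r =>
    intro M c h c' hc'
    rw [exec, PMF.mem_support_map_iff] at hc'
    obtain ⟨b, -, rfl⟩ := hc'
    exact h.push r b
  | measure q r =>
    intro M c h c' hc'
    rw [exec, PMF.mem_support_map_iff] at hc'
    obtain ⟨b, -, rfl⟩ := hc'
    exact LengthsLE.push (c := c.mapQ _) h r b
  | query o q =>
    intro M c h c' hc'
    rw [exec, PMF.mem_support_map_iff] at hc'
    obtain ⟨f, -, rfl⟩ := hc'
    exact LengthsLE.mono (c := c.mapQ _) h le_self_add
  | _ =>
    intro M c h c' hc'
    rw [exec, PMF.mem_support_pure_iff] at hc'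
    subst hc'
    exact h.mono le_self_add

theorem IsPolyTime.seq {P Q : Prog} (hP : IsPolyTime P) (hQ : IsPolyTime Q) :
    IsPolyTime (.seq P Q) := by
  obtain ⟨p, hp⟩ := hP
  obtain ⟨q, hq⟩ := hQ
  -- After `P`, all registers have length at most `N + p(N)`, and this is the input size for `Q`.
  refine ⟨p + q.comp (Polynomial.X + p), fun env N c hc => ?_⟩
  have h1 := hp env N c hc
  rw [time]
  simp only [Polynomial.eval_add, Polynomial.eval_comp, Polynomial.eval_X, Nat.cast_add]
  refine add_le_add h1 (iSup₂_le fun d hd => hq env _ d fun r => ?_)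
  have h2 := lengthsLE_exec env P N c (fun r => by exact_mod_cast hc r) d hd r
  exact_mod_cast h2.trans (add_le_add le_rfl h1)

/-- All loops of the program are over registers in `R`, and it does not write to these. -/
def Steady (R : Set ℕ) : Prog → Prop
  | .push r _ | .pop r | .copy r _ | .coin r | .measure _ r => r ∉ R
  | .seq P Q => Steady R P ∧ Steady R Q
  | .branch _ E F T => Steady R E ∧ Steady R F ∧ Steady R T
  | .loop r P => r ∈ R ∧ Steady R P
  | _ => True

theorem Config.set_reg_of_notMem {R : Set ℕ} {c : Config} {r s : ℕ} (hr : r ∉ R) (hs : s ∈ R)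
    (l : List Bool) : (c.set r l).reg s = c.reg s :=
  Function.update_of_ne (by rintro rfl; exact hr hs) _ _

theorem iterate_reg_of_step {step : Config → PMF Config} {R : Set ℕ}
    (h : ∀ c, ∀ c' ∈ (step c).support, ∀ r ∈ R, c'.reg r = c.reg r) (k : ℕ) :
    ∀ c, ∀ c' ∈ (iterate step k c).support, ∀ r ∈ R, c'.reg r = c.reg r := by
  induction k with
  | zero =>
    intro c c' hc' r _
    rw [iterate, PMF.mem_support_pure_iff] at hc'
    rw [hc']
  | succ k ih =>
    intro c c' hc' r hr
    rw [iterate, PMF.mem_support_bind_iff] at hc'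
    obtain ⟨d, hd, hc'⟩ := hc'
    rw [ih d c' hc' r hr, h c d hd r hr]

theorem Steady.reg_eq {R : Set ℕ} (env : OracleName → QOracle) {P : Prog} (hP : Steady R P) :
    ∀ c, ∀ c' ∈ (exec env P c).support, ∀ r ∈ R, c'.reg r = c.reg r := by
  induction P with
  | seq P Q ihP ihQ =>
    intro c c' hc' r hr
    rw [exec, PMF.mem_support_bind_iff] at hc'
    obtain ⟨d, hd, hc'⟩ := hc'
    rw [ihQ hP.2 d c' hc' r hr, ihP hP.1 c d hd r hr]
  | branch s E F T ihE ihF ihT =>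
    intro c c' hc' r hr
    rw [exec] at hc'
    split at hc'
    · exact ihE hP.1 c c' hc' r hr
    · exact ihF hP.2.1 c c' hc' r hr
    · exact ihT hP.2.2 c c' hc' r hr
  | loop s P ih =>
    intro c c' hc' r hr
    rw [exec] at hc'
    exact iterate_reg_of_step (ih hP.2) _ c c' hc' r hr
  | coin s | measure q s =>
    intro c c' hc' r hr
    rw [exec, PMF.mem_support_map_iff] at hc'
    obtain ⟨b, -, rfl⟩ := hc'
    exact Config.set_reg_of_notMem hP hr _
  | query o q =>
    intro c c' hc' r hr
    rw [exec, PMF.mem_support_map_iff] at hc'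
    obtain ⟨b, -, rfl⟩ := hc'
    rfl
  | push s b | pop s | copy s t =>
    intro c c' hc' r hr
    rw [exec, PMF.mem_support_pure_iff] at hc'
    subst hc'
    exact Config.set_reg_of_notMem hP hr _
  | _ =>
    intro c c' hc' r hr
    rw [exec, PMF.mem_support_pure_iff] at hc'
    subst hc'
    rfl

theorem iterateTime_le {step : Config → PMF Config} {cost : Config → ℕ∞} {I : Config → Prop}
    {t : ℕ∞} (hI : ∀ c, I c → ∀ c' ∈ (step c).support, I c') (ht : ∀ c, I c → cost c ≤ t)
    (k : ℕ) : ∀ c, I c → iterateTime step cost k c ≤ k * t := by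
  induction k with
  | zero => intro c _; simp [iterateTime]
  | succ k ih =>
    intro c hc
    rw [iterateTime, Nat.cast_add, Nat.cast_one, add_mul, one_mul, add_comm]
    exact add_le_add (iSup₂_le fun d hd => ih d (hI c hc d hd)) (ht c hc)

/-- Since the registers that control loops never change, their initial lengths bound the number of
rounds of every loop, nested ones included. A loop thus multiplies the bound for its body by `N`,
however much the other registers grow. -/
theorem Steady.time_le {R : Set ℕ} {P : Prog} (hP : Steady R P) :
    ∃ p : Polynomial ℕ, ∀ (env : OracleName → QOracle) (N : ℕ) (c : Config),
      (∀ r ∈ R, (c.reg r).length ≤ N) → time env P c ≤ (p.eval N : ℕ) := by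
  induction P with
  | seq P Q ihP ihQ =>
    obtain ⟨p, hp⟩ := ihP hP.1
    obtain ⟨q, hq⟩ := ihQ hP.2
    refine ⟨p + q, fun env N c hc => ?_⟩
    rw [time, Polynomial.eval_add, Nat.cast_add]
    refine add_le_add (hp env N c hc) (iSup₂_le fun d hd => hq env N d fun r hr => ?_)
    rw [hP.1.reg_eq env c d hd r hr]
    exact hc r hr
  | branch s E F T ihE ihF ihT =>
    obtain ⟨e, he⟩ := ihE hP.1
    obtain ⟨f, hf⟩ := ihF hP.2.1
    obtain ⟨t, ht⟩ := ihT hP.2.2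
    refine ⟨1 + (e + f + t), fun env N c hc => ?_⟩
    rw [time]
    simp only [Polynomial.eval_add, Polynomial.eval_one, Nat.cast_add, Nat.cast_one]
    gcongr
    split
    · exact (he env N c hc).trans (by rw [add_assoc]; exact le_self_add)
    · exact (hf env N c hc).trans (by rw [add_right_comm]; exact le_add_self)
    · exact (ht env N c hc).trans le_add_self
  | loop s P ih =>
    obtain ⟨p, hp⟩ := ih hP.2
    refine ⟨1 + Polynomial.X * p, fun env N c hc => ?_⟩
    rw [time]
    simp only [Polynomial.eval_add, Polynomial.eval_one, Polynomial.eval_mul, Polynomial.eval_X,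
      Nat.cast_add, Nat.cast_one, Nat.cast_mul]
    gcongr
    refine (iterateTime_le (I := fun c => ∀ r ∈ R, (c.reg r).length ≤ N) (t := (p.eval N : ℕ))
      (fun c hc d hd r hr => ?_) (fun c hc => hp env N c hc) _ c hc).trans ?_
    · rw [hP.2.reg_eq env c d hd r hr]
      exact hc r hr
    · gcongr
      exact hc s hP.1
  | _ => exact ⟨1, fun env N c _ => by simp [time]⟩

theorem Steady.isPolyTime {R : Set ℕ} {P : Prog} (hP : Steady R P) : IsPolyTime P := by
  obtain ⟨p, hp⟩ := hP.time_le
  exact ⟨p, fun env N c hc => hp env N c fun r _ => hc r⟩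

/-! ### Registers that a program does not use -/

/-- A bound for the numbers of the registers mentioned in a program. -/
def regBound : Prog → ℕ
  | .skip => 0
  | .push r _ | .pop r | .coin r | .X r | .H r | .T r | .query _ r => r + 1
  | .copy r s | .CNOT r s | .measure r s => max (r + 1) (s + 1)
  | .Toffoli r s t => max (r + 1) (max (s + 1) (t + 1))
  | .seq P Q => max (regBound P) (regBound Q)
  | .branch r E F T => max (r + 1) (max (regBound E) (max (regBound F) (regBound T)))
  | .loop r P => max (r + 1) (regBound P)

/-- Replaces the registers from number `R` on by those of `s`. -/
def graft (R : ℕ) (s : ℕ → List Bool) (c : Config) : Config :=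
  { c with reg := fun r => if r < R then c.reg r else s r }

@[simp] theorem graft_qst (R : ℕ) (s : ℕ → List Bool) (c : Config) :
    (graft R s c).qst = c.qst := rfl

theorem graft_reg_lt {R r : ℕ} (s : ℕ → List Bool) (c : Config) (h : r < R) :
    (graft R s c).reg r = c.reg r := if_pos h

theorem graft_reg_ge {R r : ℕ} (s : ℕ → List Bool) (c : Config) (h : R ≤ r) :
    (graft R s c).reg r = s r := if_neg (not_lt.mpr h)

theorem graft_set {R r : ℕ} (s : ℕ → List Bool) (c : Config) (h : r < R) (l : List Bool) :
    (graft R s c).set r l = graft R s (c.set r l) := by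
  simp only [graft, Config.set, Config.mk.injEq, and_true]
  funext x
  by_cases hx : x = r
  · subst hx; simp [h]
  · simp [hx]

theorem graft_mapQ {R : ℕ} (s : ℕ → List Bool) (c : Config) (U : QState → QState) :
    (graft R s c).mapQ U = graft R s (c.mapQ U) := rfl

theorem iterate_graft {step : Config → PMF Config} {R : ℕ} {s : ℕ → List Bool}
    (h : ∀ c, step (graft R s c) = (step c).map (graft R s)) (k : ℕ) :
    ∀ c, iterate step k (graft R s c) = (iterate step k c).map (graft R s) := by
  induction k with
  | zero => intro c; simp [iterate, PMF.pure_map]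
  | succ k ih =>
    intro c
    rw [iterate, h, PMF.bind_map, iterate, PMF.map_bind]
    congr 1
    funext d
    exact ih d

/-- Qubit addresses are lengths of mentioned registers, so the registers from `R` on influence
neither the classical control nor the choice of qubits. The qubits themselves are shared and not
grafted. -/
theorem exec_graft (env : OracleName → QOracle) {R : ℕ} (s : ℕ → List Bool) {P : Prog}
    (hP : regBound P ≤ R) :
    ∀ c, exec env P (graft R s c) = (exec env P c).map (graft R s) := by
  induction P with
  | seq P Q ihP ihQ =>
    intro c
    simp only [regBound, max_le_iff] at hP
    rw [exec, ihP hP.1, PMF.bind_map, exec, PMF.map_bind]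
    congr 1
    funext d
    exact ihQ hP.2 d
  | branch r E F T ihE ihF ihT =>
    intro c
    simp only [regBound, max_le_iff] at hP
    obtain ⟨hr, hE, hF, hT⟩ := hP
    simp only [exec, graft_reg_lt s c (show r < R from hr)]
    split
    · exact ihE hE c
    · exact ihF hF c
    · exact ihT hT c
  | loop r P ih =>
    intro c
    simp only [regBound, max_le_iff] at hP
    rw [exec, exec, graft_reg_lt s c (show r < R from hP.1)]
    exact iterate_graft (ih hP.2) _ c
  | coin r =>
    intro c
    simp only [regBound] at hP
    have hr : r < R := hP
    simp only [exec, PMF.map_comp, graft_reg_lt s c hr, graft_set s c hr]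
    rfl
  | measure q r =>
    intro c
    simp only [regBound, max_le_iff] at hP
    have hq : q < R := hP.1
    have hr : r < R := hP.2
    simp only [exec, PMF.map_comp, Config.addr, graft_reg_lt s c hq, graft_reg_lt s c hr,
      graft_mapQ, graft_set s _ hr, graft_qst]
    rfl
  | query o q =>
    intro c
    have hq : q < R := hP
    simp only [exec, PMF.map_comp, Config.addr, graft_reg_lt s c hq, graft_mapQ]
    rfl
  | skip => intro c; simp [exec, PMF.pure_map]
  | push r b | pop r =>
    intro c
    have hr : r < R := hP
    simp only [exec, PMF.pure_map, graft_reg_lt s c hr, graft_set s c hr]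
  | copy d r =>
    intro c
    simp only [regBound, max_le_iff] at hP
    simp only [exec, PMF.pure_map, graft_reg_lt s c (show r < R from hP.2),
      graft_set s c (show d < R from hP.1)]
  | X q | H q | T q =>
    intro c
    have hq : q < R := hP
    simp only [exec, PMF.pure_map, Config.addr, graft_reg_lt s c hq, graft_mapQ]
  | CNOT q r =>
    intro c
    simp only [regBound, max_le_iff] at hP
    simp only [exec, PMF.pure_map, Config.addr, graft_reg_lt s c (show q < R from hP.1),
      graft_reg_lt s c (show r < R from hP.2), graft_mapQ]
  | Toffoli q r t =>
    intro c
    simp only [regBound, max_le_iff] at hP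
    simp only [exec, PMF.pure_map, Config.addr, graft_reg_lt s c (show q < R from hP.1),
      graft_reg_lt s c (show r < R from hP.2.1), graft_reg_lt s c (show t < R from hP.2.2),
      graft_mapQ]

/-- This form lets an adversary run inside a reduction: its run from `c` determines the run from
`d`, and the private registers of the reduction come out unchanged. -/
theorem exec_of_agree (env : OracleName → QOracle) {R : ℕ} {P : Prog} (hP : regBound P ≤ R)
    {c d : Config} (hq : d.qst = c.qst) (hr : ∀ r < R, d.reg r = c.reg r) :
    exec env P d = (exec env P c).map (graft R d.reg) := by
  rw [← exec_graft env d.reg hP]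
  congr 1
  obtain ⟨dr, dq⟩ := d
  simp only [graft, Config.mk.injEq]
  refine ⟨?_, hq⟩
  funext r
  split_ifs with h
  · exact hr r h
  · rfl

/-! ### Deterministic programs -/

/-- The action on the registers of a deterministic program. -/
def run : Prog → (ℕ → List Bool) → (ℕ → List Bool)
  | .push r b, g => Function.update g r (b :: g r)
  | .pop r, g => Function.update g r (g r).tail
  | .copy d s, g => Function.update g d (g s)
  | .seq P Q, g => run Q (run P g)
  | .branch r E F T, g =>
      match g r with
      | [] => run E g
      | false :: _ => run F g
      | true :: _ => run T g
  | .loop r P, g => (run P)^[(g r).length] g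
  | _, g => g

theorem iterate_pure (F : (ℕ → List Bool) → (ℕ → List Bool)) {step : Config → PMF Config}
    (h : ∀ c, step c = PMF.pure { c with reg := F c.reg }) (k : ℕ) :
    ∀ c, iterate step k c = PMF.pure { c with reg := F^[k] c.reg } := by
  induction k with
  | zero => intro c; rfl
  | succ k ih => intro c; rw [iterate, h, PMF.pure_bind, ih, Function.iterate_succ_apply]

/-- Reduces the correctness of classical subroutines to computations with register functions,
without probability or qubits. -/
theorem exec_eq_run (env : OracleName → QOracle) {P : Prog} (hP : IsDeterministic P) :
    ∀ c, exec env P c = PMF.pure { c with reg := run P c.reg } := by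
  induction P with
  | seq P Q ihP ihQ => intro c; rw [exec, ihP hP.1, PMF.pure_bind, ihQ hP.2]; rfl
  | branch r E F T ihE ihF ihT =>
    intro c
    rcases h : c.reg r with _ | ⟨_ | _, l⟩ <;> simp only [exec, run, h]
    · exact ihE hP.1 c
    · exact ihF hP.2.1 c
    · exact ihT hP.2.2 c
  | loop r P ih => intro c; exact iterate_pure _ (ih hP) _ c
  | skip | push r b | pop r | copy d s => intro c; rfl
  | _ => exact hP.elim

/-- The program does not write to register `r`. -/
def Keeps (r : ℕ) : Prog → Prop
  | .push s _ | .pop s | .copy s _ | .coin s | .measure _ s => r ≠ s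
  | .seq P Q => Keeps r P ∧ Keeps r Q
  | .branch _ E F T => Keeps r E ∧ Keeps r F ∧ Keeps r T
  | .loop _ P => Keeps r P
  | _ => True

theorem Keeps.run_eq {r : ℕ} {P : Prog} (hP : Keeps r P) : ∀ g, run P g r = g r := by
  induction P with
  | seq P Q ihP ihQ => intro g; rw [run, ihQ hP.2, ihP hP.1]
  | branch s E F T ihE ihF ihT =>
    intro g
    rcases h : g s with _ | ⟨_ | _, l⟩ <;> simp only [run, h]
    · exact ihE hP.1 g
    · exact ihF hP.2.1 g
    · exact ihT hP.2.2 g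
  | loop s P ih =>
    intro g
    rw [run]
    generalize (g s).length = k
    induction k generalizing g with
    | zero => rfl
    | succ k ihk => rw [Function.iterate_succ_apply, ihk, ih hP]
  | push s b | pop s | copy s t => intro g; exact Function.update_of_ne hP _ _
  | _ => intro g; rfl

/-- Sequential composition of a list of programs. -/
def Prog.block (l : List Prog) : Prog := l.foldr .seq .skip

theorem run_block_cons (P : Prog) (l : List Prog) (g : ℕ → List Bool) :
    run (.block (P :: l)) g = run (.block l) (run P g) := rfl

theorem run_block_nil (g : ℕ → List Bool) : run (.block []) g = g := rfl

theorem isDeterministic_block {l : List Prog} :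
    IsDeterministic (.block l) ↔ ∀ P ∈ l, IsDeterministic P := by
  induction l with
  | nil => simp [Prog.block, IsDeterministic]
  | cons P l ih =>
    rw [List.forall_mem_cons, ← ih]
    rfl

theorem keeps_block {r : ℕ} {l : List Prog} : Keeps r (.block l) ↔ ∀ P ∈ l, Keeps r P := by
  induction l with
  | nil => simp [Prog.block, Keeps]
  | cons P l ih =>
    rw [List.forall_mem_cons, ← ih]
    rfl

theorem steady_block {R : Set ℕ} {l : List Prog} :
    Steady R (.block l) ↔ ∀ P ∈ l, Steady R P := by
  induction l with
  | nil => simp [Prog.block, Steady]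
  | cons P l ih =>
    rw [List.forall_mem_cons, ← ih]
    rfl

theorem isPolyTime_block {l : List Prog} (h : ∀ P ∈ l, IsPolyTime P) : IsPolyTime (.block l) := by
  induction l with
  | nil => exact Steady.isPolyTime (R := ∅) trivial
  | cons P l ih =>
    exact IsPolyTime.seq (h P (by simp)) (ih fun Q hQ => h Q (by simp [hQ]))

/-! ### Subroutines -/

/-- Pushes the top of `p` (or `0`) on `q`. -/
def copyTop (p q : ℕ) : Prog := .branch p (.push q false) (.push q false) (.push q true)

theorem run_copyTop (p q : ℕ) (g : ℕ → List Bool) :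
    run (copyTop p q) g = Function.update g q ((g p).headD false :: g q) := by
  rcases h : g p with _ | ⟨_ | _, l⟩ <;> simp [copyTop, run, h]

/-- Pushes the negation of the top of `p` (or of `0`) on `q`. -/
def pushNot (p q : ℕ) : Prog := .branch p (.push q true) (.push q true) (.push q false)

theorem run_pushNot (p q : ℕ) (g : ℕ → List Bool) :
    run (pushNot p q) g = Function.update g q ((!(g p).headD false) :: g q) := by
  rcases h : g p with _ | ⟨_ | _, l⟩ <;> simp [pushNot, run, h]

/-- Moves as many bits from `s` to `d` as register `b` has, padding with zeros. -/
def transfer (b s d : ℕ) : Prog := .loop b (.seq (copyTop s d) (.pop s))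

theorem readBits_ofFn_succ (k : ℕ) (l : List Bool) :
    List.ofFn (readBits (k + 1) l) = l.headD false :: List.ofFn (readBits k l.tail) := by
  rw [List.ofFn_succ]
  rcases l with _ | ⟨b, l⟩ <;> rfl

theorem ofFn_readBits_length (l : List Bool) : List.ofFn (readBits l.length l) = l := by
  induction l with
  | nil => rfl
  | cons b l ih => rw [List.length_cons, readBits_ofFn_succ]; simpa using ih

theorem run_transfer (b : ℕ) {s d : ℕ} (hsd : s ≠ d) (g : ℕ → List Bool) :
    run (transfer b s d) g d =
      (List.ofFn (readBits (g b).length (g s))).reverse ++ g d := by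
  rw [transfer, run]
  generalize (g b).length = k
  induction k generalizing g with
  | zero => simp
  | succ k ih =>
    rw [Function.iterate_succ_apply, ih, readBits_ofFn_succ]
    simp [run, run_copyTop, hsd, hsd.symm]

/-- One step of the evaluation of the gates of a circuit. Register `t` holds the wires, `t + 1` the
wires from the current one on, `t + 2` the first input of the current gate, and `t + 3` the rest of
the code. -/
def gateStep (t : ℕ) : Prog :=
  .seq (.branch (t + 3) .skip
    (.seq (.branch (t + 2) (copyTop (t + 1) (t + 2))
        (.seq (.push t true) (.pop (t + 2)))
        (.seq (pushNot (t + 1) t) (.pop (t + 2))))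
      (.copy (t + 1) t))
    (.pop (t + 1))) (.pop (t + 3))

/-- Induction on the unread code, where `acc` counts the ones read in the current block. The two
claims need each other: the end of a block either stores the value of the first input of a gate or
completes the gate and clears that register. The value of the wire `i` is stored rather than `i`
itself, which suffices because no wire is added in between. -/
theorem run_gateStep_iterate (t : ℕ) (l : List Bool) :
    ∀ (g : ℕ → List Bool) (acc : ℕ) (w : List Bool), g (t + 3) = l → g t = w →
      g (t + 1) = w.drop acc →
      (g (t + 2) = [] → (run (gateStep t))^[l.length] g t =
        (pairUp (unaryBlocks acc l)).foldl (fun (w : List Bool) (g : ℕ × ℕ) =>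
          (!(w.getD g.1 false && w.getD g.2 false)) :: w) w) ∧
      (∀ i, g (t + 2) = [w.getD i false] → (run (gateStep t))^[l.length] g t =
        (pairUp (i :: unaryBlocks acc l)).foldl (fun (w : List Bool) (g : ℕ × ℕ) =>
          (!(w.getD g.1 false && w.getD g.2 false)) :: w) w) := by
  induction l with
  | nil =>
    intro g acc w _ h2 _
    simp [unaryBlocks, pairUp, h2]
  | cons b l ih =>
    intro g acc w h3 h0 h1
    rw [List.length_cons, Function.iterate_succ_apply]
    cases b with
    | true =>
      have := ih (run (gateStep t) g) (acc + 1) w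
        (by simp [gateStep, run, h3]) (by simp [gateStep, run, h3, h0])
        (by simp [gateStep, run, h3, h1, List.tail_drop])
      have h2 : run (gateStep t) g (t + 2) = g (t + 2) := by simp [gateStep, run, h3]
      rw [h2] at this
      exact this
    | false =>
      constructor
      · intro h2
        have := (ih (run (gateStep t) g) 0 w
          (by simp [gateStep, run, run_copyTop, h3, h2])
          (by simp [gateStep, run, run_copyTop, h3, h0, h2])
          (by simp [gateStep, run, run_copyTop, h3, h0, h2])).2 acc
          (by simp [gateStep, run, run_copyTop, h3, h2, h1])
        rw [this]
        rfl
      · intro i h2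
        have := (ih (run (gateStep t) g) 0 ((!(w.getD i false && w.getD acc false)) :: w)
          (by rcases hv : w.getD i false <;> rw [hv] at h2 <;>
                simp [gateStep, run, run_pushNot, h3, h2])
          (by rcases hv : w.getD i false <;> rw [hv] at h2 <;>
                simp [gateStep, run, run_pushNot, h3, h2, h0, h1])
          (by rcases hv : w.getD i false <;> rw [hv] at h2 <;>
                simp [gateStep, run, run_pushNot, h3, h2, h0, h1])).1
          (by rcases hv : w.getD i false <;> rw [hv] at h2 <;>
                simp [gateStep, run, run_pushNot, h3, h2])
        rw [this]
        rfl

/-- One step of the output of the wires of a circuit. Register `t` holds the wires, `t + 1` the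
wires from the current one on, `t + 4` the rest of the code, and `t + 5` the output reversed. -/
def outStep (t : ℕ) : Prog :=
  .seq (.branch (t + 4) .skip (.seq (copyTop (t + 1) (t + 5)) (.copy (t + 1) t))
    (.pop (t + 1))) (.pop (t + 4))

theorem run_outStep_iterate (t : ℕ) (l : List Bool) :
    ∀ (g : ℕ → List Bool) (acc : ℕ) (w : List Bool), g (t + 4) = l → g t = w →
      g (t + 1) = w.drop acc →
      (run (outStep t))^[l.length] g (t + 5) =
        ((unaryBlocks acc l).map fun i => w.getD i false).reverse ++ g (t + 5) := by
  induction l with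
  | nil => intro g acc w _ _ _; simp [unaryBlocks]
  | cons b l ih =>
    intro g acc w h4 h0 h1
    rw [List.length_cons, Function.iterate_succ_apply]
    cases b with
    | true =>
      rw [ih _ (acc + 1) w (by simp [outStep, run, h4]) (by simp [outStep, run, h4, h0])
        (by simp [outStep, run, h4, h1, List.tail_drop])]
      simp [outStep, run, h4, unaryBlocks]
    | false =>
      rw [ih _ 0 w (by simp [outStep, run, run_copyTop, h4])
        (by simp [outStep, run, run_copyTop, h4, h0])
        (by simp [outStep, run, run_copyTop, h4, h0])]
      simp [outStep, run, run_copyTop, h4, h1, unaryBlocks]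

/-- Evaluates the circuit encoded by the registers `g` and `o` on the content of `x`, with the
result in `out`. Register `e` has to be empty; `t, …, t + 6` are used for the computation. -/
def evalCircuit (t e g o x out : ℕ) : Prog :=
  .block [.copy t x, .copy (t + 1) t, .copy (t + 2) e, .copy (t + 3) g, .loop g (gateStep t),
    .copy (t + 1) t, .copy (t + 4) o, .copy (t + 5) e, .loop o (outStep t),
    .copy out e, .copy (t + 6) (t + 5), transfer (t + 6) (t + 5) out]

theorem evalCircuit_keeps {t e g o x out r : ℕ} (h : r ≠ out) (hr : r < t ∨ t + 6 < r) :
    Keeps r (evalCircuit t e g o x out) := by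
  simp only [evalCircuit, keeps_block, List.forall_mem_cons, Keeps, gateStep, outStep, transfer,
    copyTop, pushNot, List.not_mem_nil, false_imp_iff, implies_true, and_true, true_and]
  omega

theorem evalCircuit_isDeterministic (t e g o x out : ℕ) :
    IsDeterministic (evalCircuit t e g o x out) := by
  simp [evalCircuit, isDeterministic_block, IsDeterministic, gateStep, outStep, transfer,
    copyTop, pushNot]

/-- The code is consumed in a copy, so each loop is steady for the register that it runs over. The
whole block is not, as the last loop runs over register `t + 6`, which is written earlier; hence the
bounds are composed. -/
theorem evalCircuit_isPolyTime {t e g o x out : ℕ} (hg : g < t) (ho : o < t) (hout : out < t) :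
    IsPolyTime (evalCircuit t e g o x out) := by
  refine isPolyTime_block ?_
  simp only [List.forall_mem_cons]
  have hgs (r : ℕ) (hr : r < t) : Steady {r} (.loop r (gateStep t)) := by
    simp [Steady, gateStep, copyTop, pushNot]; omega
  have hos (r : ℕ) (hr : r < t) : Steady {r} (.loop r (outStep t)) := by
    simp [Steady, outStep, copyTop]; omega
  have htr : Steady {t + 6} (transfer (t + 6) (t + 5) out) := by
    simp [Steady, transfer, copyTop]; omega
  have hc (a b : ℕ) : IsPolyTime (.copy a b) := Steady.isPolyTime (R := ∅) (by simp [Steady])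
  exact ⟨hc _ _, hc _ _, hc _ _, hc _ _, (hgs g hg).isPolyTime, hc _ _, hc _ _, hc _ _,
    (hos o ho).isPolyTime, hc _ _, hc _ _, htr.isPolyTime, by simp⟩

theorem run_evalCircuit {t e g o x out : ℕ} (reg : ℕ → List Bool) (he : reg e = [])
    (het : e < t) (hg : g < t) (ho : o < t) (hout : out < t) :
    run (evalCircuit t e g o x out) reg out =
      (decodeCircuit (reg g) (reg o)).eval (reg x) := by
  simp only [evalCircuit, run_block_cons, run_block_nil]
  rw [run_transfer _ (by omega)]
  set g4 := run (.copy (t + 3) g) (run (.copy (t + 2) e) (run (.copy (t + 1) t)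
    (run (.copy t x) reg))) with hg4
  have k4 (r : ℕ) (hr : r < t) : g4 r = reg r := by
    simp (disch := omega) only [hg4, run, Function.update_of_ne]
  set g5 := run (.loop g (gateStep t)) g4 with hg5
  have k5 (r : ℕ) (hr : r < t) : g5 r = reg r := by
    rw [hg5, Keeps.run_eq, k4 r hr]
    simp only [Keeps, gateStep, copyTop, pushNot, true_and]
    omega
  have w5 : g5 t = (pairUp (unaryBlocks 0 (reg g))).foldl (fun (w : List Bool) (g : ℕ × ℕ) =>
      (!(w.getD g.1 false && w.getD g.2 false)) :: w) (reg x) := by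
    rw [hg5, run, k4 g hg]
    refine (run_gateStep_iterate t (reg g) g4 0 (reg x) ?_ ?_ ?_).1 ?_
    all_goals simp (disch := omega) [hg4, run, Function.update_of_ne, he]
  set g8 := run (.copy (t + 5) e) (run (.copy (t + 4) o) (run (.copy (t + 1) t) g5)) with hg8
  have k8 (r : ℕ) (hr : r < t) : g8 r = reg r := by
    simp (disch := omega) only [hg8, run, Function.update_of_ne, k5]
  set g9 := run (.loop o (outStep t)) g8 with hg9
  have k9 (r : ℕ) (hr : r < t) : g9 r = reg r := by
    rw [hg9, Keeps.run_eq, k8 r hr]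
    simp only [Keeps, outStep, copyTop, true_and]
    omega
  have w9 : g9 (t + 5) = ((decodeCircuit (reg g) (reg o)).eval (reg x)).reverse := by
    rw [hg9, run, k8 o ho, run_outStep_iterate t (reg o) g8 0 (g5 t)]
    · simp (disch := omega) [hg8, run, Function.update_of_ne, k5, he, w5, Circuit.eval,
        decodeCircuit]
    all_goals simp (disch := omega) [hg8, run, Function.update_of_ne, k5]
  set g11 := run (.copy (t + 6) (t + 5)) (run (.copy out e) g9) with hg11
  have h6 : g11 (t + 6) = ((decodeCircuit (reg g) (reg o)).eval (reg x)).reverse := by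
    simp (disch := omega) only [hg11, run, Function.update_of_ne, Function.update_self, w9]
  have h5 : g11 (t + 5) = ((decodeCircuit (reg g) (reg o)).eval (reg x)).reverse := by
    simp (disch := omega) only [hg11, run, Function.update_of_ne, w9]
  have ho : g11 out = [] := by
    simp (disch := omega) only [hg11, run, Function.update_of_ne, Function.update_self, k9, he]
  rw [h6, h5, ho, ofFn_readBits_length, List.reverse_reverse, List.append_nil]

/-- One step of the comparison of the registers `t` and `t + 1`. -/
def eqStep (t : ℕ) : Prog :=
  .seq (.branch t .skip
    (.branch (t + 1) (.push (t + 2) true) .skip (.push (t + 2) true))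
    (.branch (t + 1) (.push (t + 2) true) (.push (t + 2) true) .skip))
    (.seq (.pop t) (.pop (t + 1)))

/-- Register `t + 2` records mismatches. The condition that there is none so far and that the rests
of both words agree is preserved by each step in both directions; at the end the rest of the first
word is empty. -/
theorem run_eqStep_iterate (t : ℕ) (l : List Bool) :
    ∀ g : ℕ → List Bool, g t = l →
      ((run (eqStep t))^[l.length] g (t + 2) = [] ∧ (run (eqStep t))^[l.length] g (t + 1) = [] ↔
        g (t + 2) = [] ∧ g (t + 1) = l) := by
  induction l with
  | nil => intro g _; rfl
  | cons b l ih =>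
    intro g h0
    rw [List.length_cons, Function.iterate_succ_apply, ih]
    · rcases b with _ | _ <;> rcases h1 : g (t + 1) with _ | ⟨_ | _, l'⟩ <;>
        simp [eqStep, run, h0, h1]
    · rcases b with _ | _ <;> rcases h1 : g (t + 1) with _ | ⟨_ | _, l'⟩ <;>
        simp [eqStep, run, h0, h1]

/-- Compares the registers `x` and `y` and pushes `z ⊕ [x = y]` on `x`. Register `e` has to be
empty; `t, t + 1, t + 2` are used for the computation. -/
def eqTest (t e x y : ℕ) (z : Bool) : Prog :=
  .block [.copy t x, .copy (t + 1) y, .copy (t + 2) e, .loop x (eqStep t),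
    .branch (t + 1) .skip (.push (t + 2) true) (.push (t + 2) true),
    .branch (t + 2) (.push x (!z)) (.push x z) (.push x z)]

theorem eqTest_isDeterministic (t e x y : ℕ) (z : Bool) :
    IsDeterministic (eqTest t e x y z) := by
  simp [eqTest, isDeterministic_block, IsDeterministic, eqStep]

theorem eqTest_isPolyTime {t e x y : ℕ} (z : Bool) (hx : x < t) :
    IsPolyTime (eqTest t e x y z) := by
  refine isPolyTime_block ?_
  simp only [List.forall_mem_cons]
  have hl : Steady {x} (.loop x (eqStep t)) := by
    simp [Steady, eqStep]; omega
  have hc (a b : ℕ) : IsPolyTime (.copy a b) := Steady.isPolyTime (R := ∅) (by simp [Steady])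
  exact ⟨hc _ _, hc _ _, hc _ _, hl.isPolyTime, Steady.isPolyTime (R := ∅) (by simp [Steady]),
    Steady.isPolyTime (R := ∅) (by simp [Steady]), by simp⟩

theorem run_eqTest {t e x y : ℕ} (z : Bool) (reg : ℕ → List Bool) (he : reg e = [])
    (het : e < t) (hx : x < t) (hy : y < t) :
    (run (eqTest t e x y z) reg x).headD false = (z ^^ (reg x == reg y)) := by
  simp only [eqTest, run_block_cons, run_block_nil]
  set g3 := run (.copy (t + 2) e) (run (.copy (t + 1) y) (run (.copy t x) reg)) with hg3
  have hxg : g3 x = reg x := by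
    simp (disch := omega) only [hg3, run, Function.update_of_ne]
  have key := run_eqStep_iterate t (reg x) g3 (by simp [hg3, run])
  have h31 : g3 (t + 1) = reg y := by
    simp (disch := omega) [hg3, run, Function.update_of_ne]
  have h32 : g3 (t + 2) = [] := by
    simp (disch := omega) [hg3, run, Function.update_of_ne, he]
  rw [h31, h32] at key
  have hl : run (.loop x (eqStep t)) g3 = (run (eqStep t))^[(reg x).length] g3 := by
    rw [run, hxg]
  rw [hl]
  set g4 := (run (eqStep t))^[(reg x).length] g3
  by_cases hxy : reg y = reg x
  · have := key.2 ⟨rfl, hxy⟩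
    simp [run, this.1, this.2, hxy]
  · have h1 : (reg x == reg y) = false := by simp [Ne.symm hxy]
    have h2 : ¬(g4 (t + 2) = [] ∧ g4 (t + 1) = []) := fun h => hxy (key.1 h).2
    rw [h1]
    rcases h41 : g4 (t + 1) with _ | ⟨_ | _, _⟩ <;>
      rcases h42 : g4 (t + 2) with _ | ⟨_ | _, _⟩ <;>
      first | (simp [run, h41, h42]; done) | exact absurd ⟨h42, h41⟩ h2

/-! ### Discrete probability -/

theorem bits_uniform_succ (k : ℕ) :
    PMF.uniformOfFintype (Bits (k + 1)) = (PMF.uniformOfFintype Bool).bind fun b =>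
      (PMF.uniformOfFintype (Bits k)).map fun v => (Fin.snoc v b : Bits (k + 1)) := by
  ext x
  rw [PMF.bind_apply, tsum_eq_single (x (Fin.last k)), PMF.map_apply, tsum_eq_single (Fin.init x)]
  · simp only [Fin.snoc_init_self, if_true, PMF.uniformOfFintype_apply, Fintype.card_pi,
      Fintype.card_bool, Finset.prod_const, Finset.card_univ, Fintype.card_fin]
    rw [← ENNReal.mul_inv (by simp) (by simp), pow_succ', Nat.cast_mul]
  · intro v hv
    rw [if_neg]
    intro h
    exact hv (by rw [h, Fin.init_snoc])
  · intro b hb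
    rw [PMF.map_apply, ENNReal.tsum_eq_zero.2, mul_zero]
    intro v
    rw [if_neg]
    rintro rfl
    exact hb (by simp)

/-- The first coin ends up deepest in the stack, which is why uniform strings are decomposed by
`Fin.snoc` at their last bit. -/
theorem iterate_coin (env : OracleName → QOracle) (s k : ℕ) :
    ∀ c, iterate (exec env (.coin s)) k c =
      (PMF.uniformOfFintype (Bits k)).map fun v => c.set s (List.ofFn v ++ c.reg s) := by
  induction k with
  | zero =>
    intro c
    simp only [iterate, List.ofFn_zero, List.nil_append, Config.set, Function.update_eq_self]
    exact (PMF.map_const _ _).symm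
  | succ k ih =>
    intro c
    rw [iterate, funext ih, exec, PMF.bind_map, bits_uniform_succ, PMF.map_bind]
    congr 1
    funext b
    rw [PMF.map_comp, Function.comp_apply]
    congr 1
    funext v
    change _ = c.set s (List.ofFn (Fin.snoc v b : Bits (k + 1)) ++ c.reg s)
    rw [List.ofFn_succ']
    simp [Config.set]

theorem pmf_bool_false (p : PMF Bool) : (p false).toReal = 1 - (p true).toReal := by
  have h := p.tsum_coe
  rw [tsum_fintype, Fintype.sum_bool] at h
  have h2 := congrArg ENNReal.toReal h
  rw [ENNReal.toReal_add (p.apply_ne_top _) (p.apply_ne_top _)] at h2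
  simp at h2
  linarith

theorem uniform_bool_bind {α : Type} (f : Bool → PMF α) (x : α) :
    ((PMF.uniformOfFintype Bool).bind f) x = 2⁻¹ * f true x + 2⁻¹ * f false x := by
  rw [PMF.bind_apply, tsum_fintype, Fintype.sum_bool]
  simp [PMF.uniformOfFintype_apply]

theorem pmf_map_not (p : PMF Bool) : p.map (fun v => !v) true = p false := by
  rw [PMF.map_apply, tsum_fintype, Fintype.sum_bool]
  simp

/-- Translates between the probability of guessing a hidden bit and the distinguishing gap; the
factor 2 in the bound for semantic security comes from here. -/
theorem uniform_bool_guess (D : Bool → PMF Bool) :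
    (((PMF.uniformOfFintype Bool).bind fun b => (D b).map fun v => v == b) true).toReal =
      1 / 2 + ((D true true).toReal - (D false true).toReal) / 2 := by
  have h1 : ((D true).map fun v => v == true) = D true := by
    simp only [beq_true]; exact PMF.map_id _
  have h2 : (D false).map (fun v => v == false) true = D false false := by
    simp
  rw [uniform_bool_bind, h1, h2, ENNReal.toReal_add, ENNReal.toReal_mul, ENNReal.toReal_mul,
    pmf_bool_false]
  · simp; ring
  · exact ENNReal.mul_ne_top (by simp) (PMF.apply_ne_top _ _)
  · exact ENNReal.mul_ne_top (by simp) (PMF.apply_ne_top _ _)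

/-! ### Negligible functions -/

theorem Negligible.two_mul {μ : ℕ → ℝ} (h : Negligible μ) : Negligible fun n => 2 * μ n := by
  intro p hp
  obtain ⟨N, hN⟩ := h (Polynomial.C 2 * p) fun n => by
    rw [Polynomial.eval_C_mul]
    exact mul_pos two_pos (hp n)
  refine ⟨N, fun n hn => ?_⟩
  have := hN n hn
  rw [Polynomial.eval_C_mul, lt_div_iff₀ (mul_pos two_pos (hp n))] at this
  rw [lt_div_iff₀ (hp n)]
  linarith

theorem Negligible.max {μ ν : ℕ → ℝ} (hμ : Negligible μ) (hν : Negligible ν) :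
    Negligible fun n => max (μ n) (ν n) := by
  intro p hp
  obtain ⟨N, hN⟩ := hμ p hp
  obtain ⟨M, hM⟩ := hν p hp
  exact ⟨Max.max N M, fun n hn =>
    max_lt (hN n (lt_of_le_of_lt (le_max_left _ _) hn))
      (hM n (lt_of_le_of_lt (le_max_right _ _) hn))⟩

/-! ### Encryption of the zero message -/

theorem project_single (i : ℕ) (o : Bool) (S : Finset ℕ) :
    project i o (Finsupp.single S 1) = if decide (i ∈ S) = o then Finsupp.single S 1 else 0 := by
  rw [project]
  split_ifs with h
  · exact Finsupp.filter_single_of_pos _ h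
  · exact Finsupp.filter_single_of_neg _ h

theorem normSq_single (S : Finset ℕ) : normSq (Finsupp.single S 1) = 1 := by
  simp [normSq]

theorem measureDist_single (i : ℕ) (S : Finset ℕ) :
    measureDist i (Finsupp.single S 1) = PMF.pure (decide (i ∈ S)) := by
  ext o
  have h0 : normSq 0 = 0 := by simp [normSq]
  by_cases h : i ∈ S <;> cases o <;>
    simp [measureDist, bernoulli, project_single, h, normSq_single, h0, PMF.ofFintype_apply,
      PMF.pure_apply]

/-- The basis state in which the qubits from number `a` on hold the bits of `y`. -/
def bitSet (a k : ℕ) (y : ℕ → Bool) : Finset ℕ :=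
  ((Finset.range k).filter fun j => y j = true).image fun j => a + j

theorem mem_bitSet {a k i : ℕ} {y : ℕ → Bool} :
    i ∈ bitSet a k y ↔ ∃ j < k, y j = true ∧ a + j = i := by
  simp [bitSet, and_assoc]

/-- Measures and resets one qubit, with the outcome on register `r`. The qubit is the one before
that addressed by register `p`. -/
def measureStep (p r : ℕ) : Prog :=
  .seq (.pop p) (.seq (.measure p r) (.branch r .skip .skip (.X p)))

/-- On a basis state the measurement is deterministic, and the `X` applied after outcome `1` clears
the qubit. Working from the last qubit down leaves the bits in the right order on the stack. -/
theorem exec_measureStep (env : OracleName → QOracle) {p r a k : ℕ} (hpr : p ≠ r) (y : ℕ → Bool)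
    (g : ℕ → List Bool) (hg : g p = unary (a + (k + 1))) :
    exec env (measureStep p r) ⟨g, Finsupp.single (bitSet a (k + 1) y) 1⟩ =
      PMF.pure ⟨Function.update (Function.update g p (unary (a + k))) r (y k :: g r),
        Finsupp.single (bitSet a k y) 1⟩ := by
  have hmem : (a + k ∈ bitSet a (k + 1) y) ↔ y k = true := by
    rw [mem_bitSet]
    constructor
    · rintro ⟨j, _, hj, h⟩
      rwa [← show j = k by omega]
    · intro h
      exact ⟨k, by omega, h, rfl⟩
  have htail : (unary (a + (k + 1))).tail = unary (a + k) := by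
    simp [unary, ← add_assoc]
  have haddr : (unary (a + k)).length = a + k := by simp [unary]
  simp only [measureStep, exec, PMF.pure_bind, Config.set, hg, htail, Config.addr, Config.mapQ,
    Function.update_self, haddr, measureDist_single, PMF.pure_map, project_single]
  rcases hy : y k with _ | _
  · simp only [hmem, hy, Bool.false_eq_true, decide_false, Function.update_of_ne hpr.symm, if_true]
    congr 3
    ext i
    simp only [mem_bitSet]
    constructor
    · rintro ⟨j, h1, h2, h3⟩
      refine ⟨j, lt_of_le_of_ne (by omega) ?_, h2, h3⟩
      rintro rfl
      simp [hy] at h2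
    · rintro ⟨j, h1, h2⟩
      exact ⟨j, by omega, h2⟩
  · simp only [hmem, hy, decide_true, Function.update_of_ne hpr.symm, if_true, gateX,
      Finsupp.mapDomain_single, Function.update_of_ne hpr, Function.update_self, haddr]
    congr 3
    ext i
    simp only [flipBit, Finset.mem_symmDiff, mem_bitSet, Finset.mem_singleton]
    constructor
    · rintro (⟨⟨j, h1, h2, h3⟩, h4⟩ | ⟨rfl, h⟩)
      · exact ⟨j, by omega, h2, h3⟩
      · exact absurd ⟨k, by omega, hy, rfl⟩ h
    · rintro ⟨j, h1, h2, h3⟩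
      exact Or.inl ⟨⟨j, by omega, h2, h3⟩, by omega⟩

theorem iterate_measureStep (env : OracleName → QOracle) {p r a : ℕ} (hpr : p ≠ r) (y : ℕ → Bool)
    (k : ℕ) : ∀ g : ℕ → List Bool, g p = unary (a + k) →
    iterate (exec env (measureStep p r)) k ⟨g, Finsupp.single (bitSet a k y) 1⟩ =
      PMF.pure ⟨Function.update (Function.update g p (unary a)) r ((List.range k).map y ++ g r),
        vacuum⟩ := by
  induction k with
  | zero =>
    intro g hg
    rw [add_zero] at hg
    simp [iterate, ← hg, vacuum, bitSet]
  | succ k ih =>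
    intro g hg
    rw [iterate, exec_measureStep env hpr y g hg, PMF.pure_bind,
      ih _ (by rw [Function.update_of_ne hpr, Function.update_self])]
    congr 2
    funext x
    by_cases hx : x = r
    · subst hx; simp [List.range_succ]
    · by_cases hx' : x = p
      · subst hx'; simp [hx]
      · simp [hx, hx']

/-- Pushes an encryption of the zero message on register `r`, in the initial state. Register `e`
has to be empty; `p` is used for addresses. -/
def encryptZero (r e p : ℕ) : Prog :=
  .seq (.query .enc e) (.seq (.copy p 1) (.seq (.loop 2 (.push p true)) (.loop 2 (measureStep p r))))

theorem encryptZero_isPolyTime {r e p : ℕ} (hr : 2 < r) (hp : 2 < p) :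
    IsPolyTime (encryptZero r e p) := by
  refine Steady.isPolyTime (R := {2}) ?_
  simp [encryptZero, measureStep, Steady]
  omega

theorem exec_seq (env : OracleName → QOracle) (P Q : Prog) (c : Config) :
    exec env (.seq P Q) c = (exec env P c).bind (exec env Q) := rfl

theorem exec_loop (env : OracleName → QOracle) (r : ℕ) (P : Prog) (c : Config) :
    exec env (.loop r P) c = iterate (exec env P) (c.reg r).length c := rfl

theorem exec_copy (env : OracleName → QOracle) (d s : ℕ) (c : Config) :
    exec env (.copy d s) c = PMF.pure (c.set d (c.reg s)) := rfl

theorem exec_query (env : OracleName → QOracle) (o : OracleName) (q : ℕ) (c : Config) :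
    exec env (.query o q) c =
      (env o).fn.map fun f => c.mapQ (oracleUnitary f (c.addr q)) := rfl

theorem iterate_push (env : OracleName → QOracle) (p k : ℕ) :
    ∀ c, iterate (exec env (.push p true)) k c =
      PMF.pure (c.set p (List.replicate k true ++ c.reg p)) := by
  induction k with
  | zero => intro c; simp [iterate, Config.set]
  | succ k ih =>
    intro c
    rw [iterate, exec, PMF.pure_bind, ih]
    simp [Config.set, List.replicate_succ']

/-- For a fixed tape, the query on the vacuum at address 0 yields the basis state with input zero
and the ciphertext in the qubits from number `msgLen n` on. Measuring and resetting these `ctLen n`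
qubits restores the vacuum, so only registers `p` and `r` show any trace of the query. -/
theorem exec_encryptZero (Sch : SKES) (n : ℕ) (k : Bits (Sch.keyLen n)) {r e p : ℕ} (hr : 2 < r)
    (he : 2 < e) (hp : 2 < p) (hpr : p ≠ r) :
    exec (Sch.preOracles n k) (encryptZero r e p) (Sch.start n) =
      (Sch.encDist n k (readBits _ [])).map fun ct =>
        ((Sch.start n).set p (unary (Sch.msgLen n))).set r (List.ofFn ct) := by
  have hreg (x : ℕ) (hx : 2 < x) : (Sch.start n).reg x = [] := by
    simp (disch := omega) [SKES.start, SKES.writeParams, Config.set, inputConfig,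
      Function.update_of_ne]
  have h1 : (Sch.start n).reg 1 = unary (Sch.msgLen n) := by
    simp [SKES.start, SKES.writeParams, Config.set]
  have h2 : (Sch.start n).reg 2 = unary (Sch.ctLen n) := by
    simp [SKES.start, SKES.writeParams, Config.set]
  have hq : (Sch.start n).qst = vacuum := rfl
  simp only [encryptZero, exec_seq, exec_query, SKES.preOracles, SKES.encOracle, SKES.encDist, PMF.map_comp,
    PMF.bind_map]
  rw [← PMF.bind_pure_comp]
  congr 1
  funext s
  simp only [Function.comp_apply]
  set y : ℕ → Bool := fun j =>
    if h : j < Sch.ctLen n then Sch.enc n k (readBits _ []) s ⟨j, h⟩ else false with hy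
  have hstate : oracleUnitary (fun m => Sch.enc n k m s) ((Sch.start n).addr e)
      (Sch.start n).qst = Finsupp.single (bitSet (Sch.msgLen n) (Sch.ctLen n) y) 1 := by
    rw [hq, oracleUnitary, vacuum, Finsupp.mapDomain_single]
    congr 1
    have h0 : (fun i : Fin (Sch.msgLen n) => decide ((Sch.start n).addr e + (i : ℕ) ∈
        (∅ : Finset ℕ))) = readBits _ [] := by
      funext i; simp [readBits]
    rw [h0]
    ext i
    simp only [Config.addr, hreg e he, Finset.mem_symmDiff, Finset.notMem_empty, Finset.mem_image,
      Finset.mem_filter, Finset.mem_univ, true_and, not_false_eq_true, and_true, false_and, false_or,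
      mem_bitSet, List.length_nil, zero_add, hy]
    constructor
    · rintro ⟨j, h, rfl⟩
      exact ⟨j, j.2, by simpa using h, rfl⟩
    · rintro ⟨j, hj, h, rfl⟩
      exact ⟨⟨j, hj⟩, by simpa [hj] using h, rfl⟩
  have hylist : (List.range (Sch.ctLen n)).map y = List.ofFn (Sch.enc n k (readBits _ []) s) := by
    apply List.ext_getElem
    · simp
    · intro i hi _
      simp at hi
      simp [hy, hi]
  simp only [Config.mapQ, hstate, exec_seq, exec_copy, exec_loop, PMF.pure_bind, iterate_push,
    Config.set, Function.update_self, h1]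
  simp (disch := omega) only [Function.update_of_ne, h2]
  rw [show (unary (Sch.ctLen n)).length = Sch.ctLen n by simp [unary],
    iterate_measureStep _ hpr]
  · congr 1
    rw [← hq]
    congr 1
    simp (disch := omega) [Function.update_of_ne, hylist, hreg]
  · simp [unary, add_comm]

/-! ### Register bookkeeping for the reductions -/

theorem map_exec_of_agree {β : Type} (env : OracleName → QOracle) {R : ℕ} {P : Prog}
    (hP : regBound P ≤ R) {c d : Config} (hq : d.qst = c.qst) (hr : ∀ r < R, d.reg r = c.reg r)
    {F G : Config → β} (hFG : ∀ c₂, F (graft R d.reg c₂) = G c₂) :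
    (exec env P d).map F = (exec env P c).map G := by
  rw [exec_of_agree env hP hq hr, PMF.map_comp]
  congr 1
  funext c₂
  exact hFG c₂

theorem run_seq (P Q : Prog) (g : ℕ → List Bool) : run (.seq P Q) g = run Q (run P g) := rfl

theorem run_copy (d s : ℕ) (g : ℕ → List Bool) :
    run (.copy d s) g = Function.update g d (g s) := rfl

theorem run_transfer_of_ne {b s d r : ℕ} (hs : r ≠ s) (hd : r ≠ d) (g : ℕ → List Bool) :
    run (transfer b s d) g r = g r :=
  Keeps.run_eq (by simp [transfer, copyTop, Keeps, hs, hd]) g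

theorem run_evalCircuit_of_ne {t e g o x out r : ℕ} (h : r ≠ out) (hr : r < t ∨ t + 6 < r)
    (reg : ℕ → List Bool) : run (evalCircuit t e g o x out) reg r = reg r :=
  (evalCircuit_keeps h hr).run_eq reg

theorem transfer_steady {b s d : ℕ} (hs : b ≠ s) (hd : b ≠ d) : Steady {b} (transfer b s d) := by
  simp [transfer, copyTop, Steady, hs.symm, hd.symm]

theorem copy_isPolyTime (d s : ℕ) : IsPolyTime (.copy d s) :=
  Steady.isPolyTime (R := ∅) (by simp [Steady])

theorem start_reg_of_two_lt (Sch : SKES) (n : ℕ) {x : ℕ} (hx : 2 < x) :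
    (Sch.start n).reg x = [] := by
  simp (disch := omega) [SKES.start, SKES.writeParams, Config.set, inputConfig,
    Function.update_of_ne]

theorem start_reg_one (Sch : SKES) (n : ℕ) :
    (Sch.start n).reg 1 = unary (Sch.msgLen n) := by
  simp [SKES.start, SKES.writeParams, Config.set]

theorem writeParams_reg_of_two_lt (Sch : SKES) (n : ℕ) (c : Config) {x : ℕ} (hx : 2 < x) :
    (Sch.writeParams n c).reg x = c.reg x := by
  simp (disch := omega) [SKES.writeParams, Config.set, Function.update_of_ne]

theorem writeParams_reg_congr (Sch : SKES) (n : ℕ) {c d : Config} {x : ℕ}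
    (h : c.reg x = d.reg x) : (Sch.writeParams n c).reg x = (Sch.writeParams n d).reg x := by
  simp only [SKES.writeParams, Config.set, Function.update_apply, h]

/-- A bound, at least `10`, for the registers of both programs of an adversary. -/
def QPT.bound (A : QPT) : ℕ := max 10 (max (regBound A.pre) (regBound A.post))

theorem QPT.ten_le_bound (A : QPT) : 10 ≤ A.bound := le_max_left _ _

theorem QPT.pre_le_bound (A : QPT) : regBound A.pre ≤ A.bound :=
  (le_max_left _ _).trans (le_max_right _ _)

theorem QPT.post_le_bound (A : QPT) : regBound A.post ≤ A.bound :=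
  (le_max_right _ _).trans (le_max_right _ _)

theorem readTemplate_congr {c d : Config} (h : ∀ r < 10, c.reg r = d.reg r) :
    readTemplate c = readTemplate d := by
  simp only [readTemplate, h _ (show 3 < 10 by omega), h _ (show 4 < 10 by omega),
    h _ (show 5 < 10 by omega), h _ (show 6 < 10 by omega), h _ (show 7 < 10 by omega),
    h _ (show 8 < 10 by omega), h _ (show 9 < 10 by omega)]

/-! ### Indistinguishability implies semantic security -/

/-- The memory at the beginning of the second phase of the semantic security game. -/
def semConfig (Sch : SKES) (n : ℕ) (c : Config) (m : Bits (Sch.msgLen n)) (x : List Bool) :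
    Config :=
  ((Sch.writeParams n c).set 3 ((readTemplate c).h.eval (List.ofFn m))).set 4 x

/-- The result of the second phase of the semantic security game. -/
def semPhase (Sch : SKES) (A : QPT) (n : ℕ) (k : Bits (Sch.keyLen n)) (c : Config)
    (m : Bits (Sch.msgLen n)) (x : List Bool) : PMF Bool :=
  (exec (Sch.postOracles n k) A.post (semConfig Sch n c m x)).map fun c₂ =>
    c₂.reg 5 == (readTemplate c).f.eval (List.ofFn m)

/-- The semantic security game in which an encryption of `sel m` is given in place of one
of `m`. -/
def semHybrid (Sch : SKES) (A : QPT) (n : ℕ)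
    (sel : Bits (Sch.msgLen n) → Bits (Sch.msgLen n)) : PMF Bool :=
  (Sch.keyDist n).bind fun k =>
  (exec (Sch.preOracles n k) A.pre (Sch.start n)).bind fun c =>
  ((readTemplate c).msgDist (Sch.msgLen n)).bind fun m =>
  (Sch.encDist n k (sel m)).bind fun ct => semPhase Sch A n k c m (List.ofFn ct)

/-- The simulator, which runs the adversary on an encryption of the zero message. -/
def zeroSimulator (A : QPT) : QPT where
  pre := .seq (encryptZero A.bound (A.bound + 1) (A.bound + 2)) A.pre
  post := .seq (.copy 4 A.bound) A.post
  pre_poly := by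
    have := A.ten_le_bound
    exact (encryptZero_isPolyTime (by omega) (by omega)).seq A.pre_poly
  post_poly := (copy_isPolyTime _ _).seq A.post_poly

/-- The stored ciphertext lies beyond the registers of `A` and the qubits are the vacuum again, so
`A` runs as if started afresh, independently of the ciphertext. -/
theorem exec_zeroSimulator_pre (Sch : SKES) (A : QPT) (n : ℕ) (k : Bits (Sch.keyLen n)) :
    ∃ s : Bits (Sch.ctLen n) → ℕ → List Bool, (∀ ct, s ct A.bound = List.ofFn ct) ∧
      exec (Sch.preOracles n k) (zeroSimulator A).pre (Sch.start n) =
        (Sch.encDist n k (readBits _ [])).bind fun ct =>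
          (exec (Sch.preOracles n k) A.pre (Sch.start n)).map (graft A.bound (s ct)) := by
  have h10 := A.ten_le_bound
  refine ⟨fun ct => (((Sch.start n).set (A.bound + 2) (unary (Sch.msgLen n))).set A.bound
    (List.ofFn ct)).reg, fun ct => by simp [Config.set], ?_⟩
  simp only [zeroSimulator]
  rw [exec_seq, exec_encryptZero Sch n k (by omega) (by omega) (by omega) (by omega),
    PMF.bind_map]
  congr 1
  funext ct
  refine exec_of_agree _ A.pre_le_bound rfl fun r hr => ?_
  simp (disch := omega) only [Config.set, Function.update_of_ne]

theorem templateDist_zeroSimulator (Sch : SKES) (A : QPT) (n : ℕ) :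
    templateDist Sch A n = templateDist Sch (zeroSimulator A) n := by
  have h10 := A.ten_le_bound
  rw [templateDist, templateDist]
  congr 1
  funext k
  obtain ⟨s, -, hs⟩ := exec_zeroSimulator_pre Sch A n k
  simp only [hs, PMF.map_bind, PMF.map_comp]
  -- The template occupies registers up to 9, hence the lower bound 10 on `A.bound`.
  have hrt (ct : Bits (Sch.ctLen n)) : readTemplate ∘ graft A.bound (s ct) = readTemplate := by
    funext c
    exact readTemplate_congr fun r hr => graft_reg_lt _ _ (by omega)
  simp only [hrt, PMF.bind_const]

theorem semGame_zeroSimulator (Sch : SKES) (A : QPT) (n : ℕ) :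
    semGame Sch (zeroSimulator A) false n = semHybrid Sch A n fun _ => readBits _ [] := by
  have h10 := A.ten_le_bound
  rw [semGame, semHybrid]
  congr 1
  funext k
  obtain ⟨s, hs, hpre⟩ := exec_zeroSimulator_pre Sch A n k
  -- The simulator encrypts zero before the first phase, the hybrid game after the plaintext is
  -- drawn; given `k` these draws are independent.
  have hswap : ((exec (Sch.preOracles n k) A.pre (Sch.start n)).bind fun c =>
      ((readTemplate c).msgDist (Sch.msgLen n)).bind fun m =>
      (Sch.encDist n k (readBits _ [])).bind fun ct => semPhase Sch A n k c m (List.ofFn ct)) =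
      (Sch.encDist n k (readBits _ [])).bind fun ct =>
      (exec (Sch.preOracles n k) A.pre (Sch.start n)).bind fun c =>
      ((readTemplate c).msgDist (Sch.msgLen n)).bind fun m =>
        semPhase Sch A n k c m (List.ofFn ct) := by
    rw [PMF.bind_comm]
    congr 1
    funext c
    exact PMF.bind_comm _ _ _
  rw [hpre, PMF.bind_bind, hswap]
  congr 1
  funext ct
  rw [PMF.bind_map]
  congr 1
  funext c
  have hrt : readTemplate (graft A.bound (s ct) c) = readTemplate c :=
    readTemplate_congr fun r hr => graft_reg_lt _ _ (by omega)
  simp only [Function.comp_apply, hrt]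
  congr 1
  funext m
  simp only [Bool.false_eq_true, if_false, PMF.bind_const, zeroSimulator, exec_seq, exec_copy,
    PMF.pure_bind, semPhase]
  refine map_exec_of_agree _ A.post_le_bound ?_ ?_ fun c₂ => ?_
  · rfl
  · intro r hr
    have hA : (Sch.writeParams n (graft A.bound (s ct) c)).reg A.bound = List.ofFn ct := by
      rw [writeParams_reg_of_two_lt _ _ _ (by omega), graft_reg_ge _ _ le_rfl, hs]
    have hr' : (Sch.writeParams n (graft A.bound (s ct) c)).reg r =
        (Sch.writeParams n c).reg r := writeParams_reg_congr _ _ (graft_reg_lt _ _ hr)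
    simp only [semConfig, Config.set, Function.update_of_ne (show A.bound ≠ 4 by omega),
      Function.update_of_ne (show A.bound ≠ 3 by omega), hA, Function.update_idem]
    simp only [Function.update_apply, hr']
  · rw [graft_reg_lt _ _ (by omega)]

theorem semGame_true (Sch : SKES) (A : QPT) (n : ℕ) :
    semGame Sch A true n = semHybrid Sch A n id := rfl

/-- Evaluates the template of the adversary: the plaintext is written to register `4`, and the
values of `h` and `f` to registers `R + 7` and `R + 8`. The coins are in register `R + 2`, the
message length is in register `R`. -/
def evalTemplate (R : ℕ) : Prog :=
  .block [evalCircuit (R + 10) (R + 1) 4 5 (R + 2) (R + 3), .copy (R + 4) (R + 3),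
    transfer R (R + 4) (R + 5), transfer R (R + 5) (R + 6),
    evalCircuit (R + 10) (R + 1) 6 7 (R + 6) (R + 7),
    evalCircuit (R + 10) (R + 1) 8 9 (R + 6) (R + 8),
    .copy 4 (R + 3), .copy 3 (R + 1)]

theorem evalTemplate_isDeterministic (R : ℕ) : IsDeterministic (evalTemplate R) := by
  rw [evalTemplate, isDeterministic_block]
  simp only [List.forall_mem_cons]
  exact ⟨evalCircuit_isDeterministic .., trivial, by simp [transfer, copyTop, IsDeterministic],
    by simp [transfer, copyTop, IsDeterministic], evalCircuit_isDeterministic ..,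
    evalCircuit_isDeterministic .., trivial, trivial, by simp⟩

theorem evalTemplate_isPolyTime {R : ℕ} (hR : 10 ≤ R) : IsPolyTime (evalTemplate R) := by
  refine isPolyTime_block ?_
  simp only [List.forall_mem_cons]
  exact ⟨evalCircuit_isPolyTime (by omega) (by omega) (by omega), copy_isPolyTime _ _,
    (transfer_steady (by omega) (by omega)).isPolyTime,
    (transfer_steady (by omega) (by omega)).isPolyTime,
    evalCircuit_isPolyTime (by omega) (by omega) (by omega),
    evalCircuit_isPolyTime (by omega) (by omega) (by omega),
    copy_isPolyTime _ _, copy_isPolyTime _ _, by simp⟩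

/-- The output of `Samp` may have any length, whereas `h` and `f` are applied to exactly `ℓ` bits.
The first transfer truncates or pads and thereby reverses, the second restores the order. -/
theorem run_evalTemplate {R ℓ : ℕ} (hR : 10 ≤ R) (g : ℕ → List Bool) (hL : g R = unary ℓ)
    (h1 : g (R + 1) = []) (h5 : g (R + 5) = []) (h6 : g (R + 6) = []) :
    run (evalTemplate R) g 4 = (decodeCircuit (g 4) (g 5)).eval (g (R + 2)) ∧
    run (evalTemplate R) g 3 = [] ∧ run (evalTemplate R) g (R + 1) = [] ∧
    run (evalTemplate R) g (R + 7) = (decodeCircuit (g 6) (g 7)).eval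
      (List.ofFn (readBits ℓ ((decodeCircuit (g 4) (g 5)).eval (g (R + 2))))) ∧
    run (evalTemplate R) g (R + 8) = (decodeCircuit (g 8) (g 9)).eval
      (List.ofFn (readBits ℓ ((decodeCircuit (g 4) (g 5)).eval (g (R + 2))))) ∧
    ∀ r < R, r ≠ 3 → r ≠ 4 → run (evalTemplate R) g r = g r := by
  simp only [evalTemplate, run_block_cons, run_block_nil, run_copy]
  set M := (decodeCircuit (g 4) (g 5)).eval (g (R + 2)) with hM
  set g1 := run (evalCircuit (R + 10) (R + 1) 4 5 (R + 2) (R + 3)) g with hg1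
  have v1 : g1 (R + 3) = M :=
    run_evalCircuit g h1 (by omega) (by omega) (by omega) (by omega)
  have k1 (r : ℕ) (h : r ≠ R + 3) (hr : r < R + 10) : g1 r = g r :=
    run_evalCircuit_of_ne h (by omega) g
  set g3 := run (transfer R (R + 4) (R + 5)) (Function.update g1 (R + 4) (g1 (R + 3))) with hg3
  have hlen : (unary ℓ).length = ℓ := by simp [unary]
  have v3 : g3 (R + 5) = (List.ofFn (readBits ℓ M)).reverse := by
    rw [hg3, run_transfer _ (by omega)]
    rw [Function.update_self, Function.update_of_ne (show R ≠ R + 4 by omega),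
      Function.update_of_ne (show R + 5 ≠ R + 4 by omega), k1 R (by omega) (by omega), hL, v1,
      k1 (R + 5) (by omega) (by omega), h5, hlen, List.append_nil]
  have k3 (r : ℕ) (h : r < R + 4 ∨ R + 5 < r) : g3 r = g1 r := by
    rw [hg3, run_transfer_of_ne (by omega) (by omega), Function.update_of_ne (by omega)]
  set g4 := run (transfer R (R + 5) (R + 6)) g3 with hg4
  have v4 : g4 (R + 6) = List.ofFn (readBits ℓ M) := by
    rw [hg4, run_transfer _ (by omega), k3 R (by omega), k1 R (by omega) (by omega), hL,
      k3 (R + 6) (by omega), k1 (R + 6) (by omega) (by omega), h6, v3, hlen, List.append_nil]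
    have := ofFn_readBits_length (List.ofFn (readBits ℓ M)).reverse
    rw [List.length_reverse, List.length_ofFn] at this
    rw [this, List.reverse_reverse]
  have k4 (r : ℕ) (h : r < R + 4 ∨ R + 6 < r) : g4 r = g1 r := by
    rw [hg4, run_transfer_of_ne (by omega) (by omega), k3 r (by omega)]
  set g5 := run (evalCircuit (R + 10) (R + 1) 6 7 (R + 6) (R + 7)) g4 with hg5
  have v5 : g5 (R + 7) = (decodeCircuit (g 6) (g 7)).eval (List.ofFn (readBits ℓ M)) := by
    rw [hg5, run_evalCircuit g4 _ (by omega) (by omega) (by omega) (by omega), v4]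
    · simp (disch := omega) only [k4, k1]
    · simp (disch := omega) only [k4, k1, h1]
  have k5 (r : ℕ) (h : r ≠ R + 7) (hr : r < R + 10) : g5 r = g4 r :=
    run_evalCircuit_of_ne h (by omega) g4
  set g6 := run (evalCircuit (R + 10) (R + 1) 8 9 (R + 6) (R + 8)) g5 with hg6
  have v6 : g6 (R + 8) = (decodeCircuit (g 8) (g 9)).eval (List.ofFn (readBits ℓ M)) := by
    rw [hg6, run_evalCircuit g5 _ (by omega) (by omega) (by omega) (by omega),
      k5 (R + 6) (by omega) (by omega), v4]
    · simp (disch := omega) only [k5, k4, k1]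
    · simp (disch := omega) only [k5, k4, k1, h1]
  have k6 (r : ℕ) (h : r ≠ R + 8) (hr : r < R + 10) : g6 r = g5 r :=
    run_evalCircuit_of_ne h (by omega) g5
  refine ⟨?_, ?_, ?_, ?_, ?_, fun r hr h3 h4 => ?_⟩
  all_goals simp (disch := omega) only [Function.update_of_ne, Function.update_self, k6, k5, k4, k1,
    v1, v5, v6, h1]

/-- The distinguisher obtained from an adversary against semantic security. It asks for an
encryption of the zero message or of the plaintext, and guesses `z ⊕ [s = f(m)]`. -/
def semDistinguisher (A : QPT) (z : Bool) : QPT where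
  pre := .seq (.copy A.bound 1) (.seq A.pre
    (.seq (.loop 3 (.coin (A.bound + 2))) (evalTemplate A.bound)))
  post := .seq (.copy 3 (A.bound + 7)) (.seq A.post
    (eqTest (A.bound + 10) (A.bound + 1) 5 (A.bound + 8) z))
  pre_poly := by
    have := A.ten_le_bound
    refine (copy_isPolyTime _ _).seq (A.pre_poly.seq (IsPolyTime.seq ?_
      (evalTemplate_isPolyTime this)))
    refine Steady.isPolyTime (R := {3}) ?_
    simp [Steady]
    omega
  post_poly := by
    have := A.ten_le_bound
    exact (copy_isPolyTime _ _).seq (A.post_poly.seq (eqTest_isPolyTime z (by omega)))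

/-- The message length is saved first, since `A` may overwrite register 1. The map `F` retains what
the second phase and the challenger need: the values of `h` and `f` at the sampled plaintext, an
empty register, and the memory of `A` outside registers 3 and 4. -/
theorem exec_semDistinguisher_pre (Sch : SKES) (A : QPT) (z : Bool) (n : ℕ)
    (k : Bits (Sch.keyLen n)) :
    ∃ F : (c : Config) → Bits (readTemplate c).coins → Config,
      exec (Sch.preOracles n k) (semDistinguisher A z).pre (Sch.start n) =
        ((exec (Sch.preOracles n k) A.pre (Sch.start n)).bind fun c =>
          (PMF.uniformOfFintype (Bits (readTemplate c).coins)).map (F c)) ∧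
      ∀ c r, (F c r).qst = c.qst ∧
        (F c r).reg 4 = (readTemplate c).samp.eval (List.ofFn r) ∧
        (F c r).reg 3 = [] ∧ (F c r).reg (A.bound + 1) = [] ∧
        (F c r).reg (A.bound + 7) = (readTemplate c).h.eval (List.ofFn (readBits (Sch.msgLen n)
          ((readTemplate c).samp.eval (List.ofFn r)))) ∧
        (F c r).reg (A.bound + 8) = (readTemplate c).f.eval (List.ofFn (readBits (Sch.msgLen n)
          ((readTemplate c).samp.eval (List.ofFn r)))) ∧
        ∀ x < A.bound, x ≠ 3 → x ≠ 4 → (F c r).reg x = c.reg x := by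
  have h10 := A.ten_le_bound
  set c0 := (Sch.start n).set A.bound (unary (Sch.msgLen n)) with hc0
  set G : (c : Config) → Bits (readTemplate c).coins → Config := fun c r =>
    (graft A.bound c0.reg c).set (A.bound + 2) (List.ofFn r) with hG
  refine ⟨fun c r => ⟨run (evalTemplate A.bound) (G c r).reg, c.qst⟩, ?_, fun c r => ?_⟩
  · simp only [semDistinguisher, exec_seq, exec_copy, PMF.pure_bind, start_reg_one]
    rw [exec_of_agree (c := Sch.start n) (d := c0) _ A.pre_le_bound, PMF.bind_map]
    · congr 1
      funext c
      have h3 : (graft A.bound c0.reg c).reg 3 = c.reg 3 := graft_reg_lt _ _ (by omega)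
      have hs : (graft A.bound c0.reg c).reg (A.bound + 2) = [] := by
        rw [graft_reg_ge _ _ (by omega)]
        simp (disch := omega) only [hc0, Config.set, Function.update_of_ne, start_reg_of_two_lt]
      rw [Function.comp_apply, exec_seq, exec_loop, h3, iterate_coin, PMF.bind_map, hs]
      rw [← PMF.bind_pure_comp]
      congr 1
      funext r
      rw [Function.comp_apply, exec_eq_run _ (evalTemplate_isDeterministic _), List.append_nil]
      rfl
    · rfl
    · intro r hr
      simp (disch := omega) only [hc0, Config.set, Function.update_of_ne]
  · have hlt (x : ℕ) (hx : x < A.bound) : (G c r).reg x = c.reg x := by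
      simp (disch := omega) only [hG, Config.set, Function.update_of_ne, graft_reg_lt]
    have hge (x : ℕ) (hx : A.bound < x) (hx' : x ≠ A.bound + 2) : (G c r).reg x = [] := by
      simp (disch := omega) only [hG, Config.set, Function.update_of_ne, graft_reg_ge, hc0,
        start_reg_of_two_lt]
    have hL : (G c r).reg A.bound = unary (Sch.msgLen n) := by
      simp (disch := omega) only [hG, Config.set, Function.update_of_ne, graft_reg_ge, hc0,
        Function.update_self]
    have hr : (G c r).reg (A.bound + 2) = List.ofFn r := by
      simp only [hG, Config.set, Function.update_self]
    obtain ⟨e1, e2, e3, e4, e5, e6⟩ := run_evalTemplate h10 (G c r).reg hL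
      (hge _ (by omega) (by omega)) (hge _ (by omega) (by omega)) (hge _ (by omega) (by omega))
    rw [hlt 4 (by omega), hlt 5 (by omega), hr] at e1 e4 e5
    rw [hlt 6 (by omega), hlt 7 (by omega)] at e4
    rw [hlt 8 (by omega), hlt 9 (by omega)] at e5
    exact ⟨rfl, e1, e2, e3, e4, e5, fun x hx h3 h4 => (e6 x hx h3 h4).trans (hlt x hx)⟩

theorem exec_semDistinguisher_post (Sch : SKES) (A : QPT) (z : Bool) (n : ℕ)
    (k : Bits (Sch.keyLen n)) {c d : Config} (m : Bits (Sch.msgLen n)) (x : List Bool)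
    (hq : d.qst = c.qst) (h1 : d.reg (A.bound + 1) = [])
    (h7 : d.reg (A.bound + 7) = (readTemplate c).h.eval (List.ofFn m))
    (h8 : d.reg (A.bound + 8) = (readTemplate c).f.eval (List.ofFn m))
    (hlt : ∀ x < A.bound, x ≠ 3 → x ≠ 4 → d.reg x = c.reg x) :
    ((exec (Sch.postOracles n k) (semDistinguisher A z).post
      ((Sch.writeParams n d).set 4 x)).map fun c₂ => (c₂.reg 5).headD false) =
      (semPhase Sch A n k c m x).map fun v => z ^^ v := by
  have h10 := A.ten_le_bound
  simp only [semDistinguisher, exec_seq, exec_copy, PMF.pure_bind, semPhase, PMF.map_comp,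
    PMF.map_bind]
  have hdet (c₁ : Config) : exec (Sch.postOracles n k)
      (eqTest (A.bound + 10) (A.bound + 1) 5 (A.bound + 8) z) c₁ = _ :=
    exec_eq_run _ (eqTest_isDeterministic _ _ _ _ _) c₁
  simp only [hdet, PMF.pure_map]
  rw [show (fun a : Config => PMF.pure ((run (eqTest (A.bound + 10) (A.bound + 1) 5
    (A.bound + 8) z) a.reg 5).headD false)) = PMF.pure ∘ fun a : Config => ((run (eqTest
    (A.bound + 10) (A.bound + 1) 5 (A.bound + 8) z) a.reg 5).headD false) from rfl,
    PMF.bind_pure_comp]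
  have hbig (y : ℕ) (hy : 4 < y) : (((Sch.writeParams n d).set 4 x).set 3
      (((Sch.writeParams n d).set 4 x).reg (A.bound + 7))).reg y = d.reg y := by
    simp (disch := omega) only [Config.set, Function.update_of_ne, writeParams_reg_of_two_lt]
  refine map_exec_of_agree _ A.post_le_bound (c := semConfig Sch n c m x) ?_ ?_ fun c₂ => ?_
  · exact hq
  · intro y hy
    have h7' : ((Sch.writeParams n d).set 4 x).reg (A.bound + 7) =
        (readTemplate c).h.eval (List.ofFn m) := by
      rw [← h7]
      simp (disch := omega) only [Config.set, Function.update_of_ne, writeParams_reg_of_two_lt]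
    rw [h7']
    by_cases h3 : y = 3
    · subst h3
      simp (disch := omega) only [semConfig, Config.set, Function.update_of_ne,
        Function.update_self]
    · by_cases h4 : y = 4
      · subst h4
        simp (disch := omega) only [semConfig, Config.set, Function.update_of_ne,
          Function.update_self]
      · simp (disch := omega) only [semConfig, Config.set, Function.update_of_ne]
        exact writeParams_reg_congr _ _ (hlt y hy h3 h4)
  · rw [run_eqTest z _ _ (by omega) (by omega) (by omega), graft_reg_lt _ _ (by omega),
      graft_reg_ge _ _ (by omega), hbig _ (by omega), h8]
    · rfl
    · rw [graft_reg_ge _ _ (by omega), hbig _ (by omega), h1]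

theorem indGame_semDistinguisher (Sch : SKES) (A : QPT) (z : Bool) (n : ℕ) :
    indGame Sch (semDistinguisher A z) n =
      (PMF.uniformOfFintype Bool).bind fun b =>
        ((semHybrid Sch A n (if b then id else fun _ => readBits _ [])).map
          fun v => z ^^ v).map fun v => v == b := by
  rw [indGame, PMF.bind_comm]
  congr 1
  funext b
  simp only [semHybrid, PMF.map_bind]
  congr 1
  funext k
  obtain ⟨F, hF, hprop⟩ := exec_semDistinguisher_pre Sch A z n k
  rw [hF, PMF.bind_bind]
  congr 1
  funext c
  rw [PMF.bind_map, Template.msgDist, PMF.bind_map]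
  congr 1
  funext r
  obtain ⟨p1, p2, p3, p4, p5, p6, p7⟩ := hprop c r
  simp only [Function.comp_apply]
  -- The empty register 3 is read, with padding, as the zero message.
  have hsel : readBits (Sch.msgLen n) ((F c r).reg (if b then 4 else 3)) =
      (if b then id else fun _ => readBits _ [] : Bits (Sch.msgLen n) → Bits (Sch.msgLen n))
        (readBits (Sch.msgLen n) ((readTemplate c).samp.eval (List.ofFn r))) := by
    cases b
    · simp [p3]
    · simp [p2]
  rw [hsel]
  congr 1
  funext ct
  rw [← exec_semDistinguisher_post Sch A z n k _ _ p1 p4 p5 p6 p7, PMF.map_comp]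
  rfl

theorem indqcca1_semqcca1 {Sch : SKES} (h : INDQCCA1 Sch) : SEMQCCA1 Sch := by
  intro A
  refine ⟨zeroSimulator A, templateDist_zeroSimulator Sch A, ?_⟩
  -- For `z = 0` the advantage is half of the difference of the two hybrids, for `z = 1` half of its
  -- negative.
  obtain ⟨μ, hμ, h1⟩ := h (semDistinguisher A false)
  obtain ⟨ν, hν, h2⟩ := h (semDistinguisher A true)
  refine ⟨_, hμ.two_mul.max hν.two_mul, fun n => ?_⟩
  have h1 := h1 n
  have h2 := h2 n
  rw [indGame_semDistinguisher, uniform_bool_guess] at h1 h2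
  rw [semGame_true, semGame_zeroSimulator]
  simp only [Bool.false_bne, Bool.true_bne, pmf_map_not, pmf_bool_false, if_true,
    Bool.false_eq_true, if_false] at h1 h2
  have hid (p : PMF Bool) : p.map (fun v => v) = p := PMF.map_id p
  rw [hid, hid] at h1
  rw [le_max_iff]
  rcases abs_cases ((semHybrid Sch A n id true).toReal -
    (semHybrid Sch A n (fun _ => readBits _ []) true).toReal) with ⟨h, -⟩ | ⟨h, -⟩
  · left; rw [h]; linarith
  · right; rw [h]; linarith

/-! ### Semantic security implies indistinguishability -/

/-- Pushes a word on register `r`. -/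
def pushList (r : ℕ) : List Bool → Prog
  | [] => .skip
  | b :: l => .seq (pushList r l) (.push r b)

theorem run_push (r : ℕ) (b : Bool) (g : ℕ → List Bool) :
    run (.push r b) g = Function.update g r (b :: g r) := rfl

theorem run_loop (r : ℕ) (P : Prog) (g : ℕ → List Bool) :
    run (.loop r P) g = (run P)^[(g r).length] g := rfl

theorem run_pushList (r : ℕ) (l : List Bool) (g : ℕ → List Bool) :
    run (pushList r l) g = Function.update g r (l ++ g r) := by
  induction l with
  | nil => simp [pushList, run]
  | cons b l ih => simp [pushList, run, ih]

theorem pushList_isDeterministic (r : ℕ) (l : List Bool) : IsDeterministic (pushList r l) := by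
  induction l with
  | nil => trivial
  | cons b l ih => exact ⟨ih, trivial⟩

theorem pushList_steady {R : Set ℕ} {r : ℕ} (hr : r ∉ R) (l : List Bool) :
    Steady R (pushList r l) := by
  induction l with
  | nil => trivial
  | cons b l ih => exact ⟨ih, hr⟩

theorem pushList_keeps {x r : ℕ} (h : x ≠ r) (l : List Bool) : Keeps x (pushList r l) := by
  induction l with
  | nil => trivial
  | cons b l ih => exact ⟨ih, h⟩

/-- The wire among `¬ β, 1, β, 0` that carries `y` for `β = 1` and `x` for `β = 0`. -/
def selIndex : Bool → Bool → ℕ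
  | false, false => 3
  | false, true => 2
  | true, false => 0
  | true, true => 1

/-- The code of a natural number as a block `1 … 1 0`. -/
def unaryBlock (i : ℕ) : List Bool := List.replicate i true ++ [false]

theorem unaryBlocks_replicate (acc i : ℕ) (l : List Bool) :
    unaryBlocks acc (List.replicate i true ++ l) = unaryBlocks (acc + i) l := by
  induction i generalizing acc with
  | zero => rfl
  | succ i ih =>
    rw [List.replicate_succ, List.cons_append, unaryBlocks, ih, add_right_comm, add_assoc]

theorem unaryBlocks_unaryBlock (i : ℕ) (l : List Bool) :
    unaryBlocks 0 (unaryBlock i ++ l) = i :: unaryBlocks 0 l := by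
  rw [unaryBlock, List.append_assoc, unaryBlocks_replicate, zero_add]
  rfl

/-- Pushes on `o` the code of the wire for the tops of `a` and `b`, and removes these. -/
def selStep (a b o : ℕ) : Prog :=
  .seq (.branch a .skip
    (.branch b .skip (pushList o (unaryBlock 3)) (pushList o (unaryBlock 2)))
    (.branch b .skip (pushList o (unaryBlock 0)) (pushList o (unaryBlock 1))))
    (.seq (.pop a) (.pop b))

theorem run_selStep {a b o : ℕ} (hab : a ≠ b) (hao : a ≠ o) (hbo : b ≠ o) {x y : Bool}
    {as bs : List Bool} (g : ℕ → List Bool) (ha : g a = x :: as) (hb : g b = y :: bs) :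
    run (selStep a b o) g a = as ∧ run (selStep a b o) g b = bs ∧
      run (selStep a b o) g o = unaryBlock (selIndex x y) ++ g o := by
  cases x <;> cases y <;>
    simp [selStep, run, run_pushList, ha, hb, selIndex, hab, hao, hbo, hab.symm, hao.symm,
      hbo.symm]

/-- The list `[!β, true, β]` holds the wires of the sampling circuit; index 3 names a missing wire
and so carries 0. As the codes are pushed on a stack, the order is reversed, and the messages have
to be supplied reversed. -/
theorem run_selStep_iterate {a b o : ℕ} (hab : a ≠ b) (hao : a ≠ o) (hbo : b ≠ o) (β : Bool)
    (as : List Bool) : ∀ (bs : List Bool) (g : ℕ → List Bool), bs.length = as.length →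
      g a = as → g b = bs →
      (unaryBlocks 0 ((run (selStep a b o))^[as.length] g o)).map
          (fun i => [!β, true, β].getD i false) =
        (if β then bs else as).reverse ++
          (unaryBlocks 0 (g o)).map (fun i => [!β, true, β].getD i false) := by
  induction as with
  | nil =>
    intro bs g hl _ _
    rw [List.length_nil, List.length_eq_zero_iff] at hl
    simp [hl]
  | cons x as ih =>
    intro bs g hl ha hb
    obtain _ | ⟨y, bs⟩ := bs
    · simp at hl
    · obtain ⟨h1, h2, h3⟩ := run_selStep hab hao hbo g ha hb
      rw [List.length_cons, Function.iterate_succ_apply, ih bs _ (by simpa using hl) h1 h2, h3,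
        unaryBlocks_unaryBlock]
      cases β <;> cases x <;> cases y <;> simp [selIndex]

/-- Pushes the code of the length of `c` on `o` and increments `c`, if that length is at most that
of `L`. -/
def countStep (L c t o : ℕ) : Prog :=
  .seq (.push o false) (.seq (.copy t c)
    (.seq (.loop L (.branch t .skip .skip (.seq (.push o true) (.pop t)))) (.push c true)))

/-- The number of rounds `k` comes from a register that stays fixed, as a steady program requires,
instead of from the growing counter; the `k - i` surplus rounds find `t` empty and do nothing. -/
theorem run_count_iterate {t o : ℕ} (hto : t ≠ o) (k : ℕ) :
    ∀ (i : ℕ) (g : ℕ → List Bool), i ≤ k → g t = List.replicate i true →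
      (run (.branch t .skip .skip (.seq (.push o true) (.pop t))))^[k] g o =
        List.replicate i true ++ g o := by
  induction k with
  | zero =>
    intro i g hi _
    obtain rfl : i = 0 := by omega
    rfl
  | succ k ih =>
    intro i g hi hg
    rw [Function.iterate_succ_apply]
    cases i with
    | zero =>
      have : run (.branch t .skip .skip (.seq (.push o true) (.pop t))) g = g := by
        simp [run, hg]
      rw [this]
      exact ih 0 g (by omega) hg
    | succ i =>
      rw [ih i _ (by omega)]
      · rw [show List.replicate (i + 1) true ++ g o = List.replicate i true ++ (true :: g o) by
          simp [List.replicate_succ']]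
        simp [run, hg, List.replicate_succ, hto.symm]
      · simp [run, hg, List.replicate_succ, hto]

theorem run_countStep {L c t o : ℕ} (hLc : L ≠ c) (hLt : L ≠ t) (hLo : L ≠ o) (hct : c ≠ t)
    (hco : c ≠ o) (hto : t ≠ o) {j : ℕ} (g : ℕ → List Bool) (hj : j ≤ (g L).length)
    (hc : g c = List.replicate j true) :
    run (countStep L c t o) g c = List.replicate (j + 1) true ∧
      run (countStep L c t o) g L = g L ∧
      run (countStep L c t o) g o = unaryBlock j ++ g o := by
  have hkeep {r : ℕ} (ht : r ≠ t) (ho : r ≠ o) :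
      Keeps r (.loop L (.branch t .skip .skip (.seq (.push o true) (.pop t)))) := by
    simp [Keeps, ht, ho]
  refine ⟨?_, ?_, ?_⟩
  · rw [countStep, run_seq, run_seq, run_seq, run_push c true, Function.update_self, (hkeep hct hco).run_eq]
    simp [run, hct, hco, hc, List.replicate_succ]
  · rw [countStep, run_seq, run_seq, run_seq, run_push c true, Function.update_of_ne hLc, (hkeep hLt hLo).run_eq]
    simp [run, hLt, hLo]
  · rw [countStep, run_seq, run_seq, run_seq, run_push c true, Function.update_of_ne hco.symm, run_loop,
      run_count_iterate hto _ j]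
    · simp [run, hto.symm, unaryBlock]
    · simpa [run, hLt, hLo] using hj
    · simp [run, hco, hc]

/-- Used from `j = 0` to write the output wires of `f`. They come out in descending order, so `f`
reverses the message instead of copying it; injectivity is all that is needed of `f`. -/
theorem run_countStep_iterate {L c t o : ℕ} (hLc : L ≠ c) (hLt : L ≠ t) (hLo : L ≠ o)
    (hct : c ≠ t) (hco : c ≠ o) (hto : t ≠ o) (k : ℕ) :
    ∀ (j : ℕ) (g : ℕ → List Bool), j + k ≤ (g L).length → g c = List.replicate j true →
      unaryBlocks 0 ((run (countStep L c t o))^[k] g o) =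
        (List.range' j k).reverse ++ unaryBlocks 0 (g o) := by
  induction k with
  | zero => intro j g _ _; simp
  | succ k ih =>
    intro j g hj hc
    obtain ⟨h1, h2, h3⟩ := run_countStep hLc hLt hLo hct hco hto g (by omega) hc
    rw [Function.iterate_succ_apply, ih (j + 1) _ (by rw [h2]; omega) h1, h3,
      unaryBlocks_unaryBlock]
    simp [List.range'_succ]

/-- Saves the registers `3, 5, …, 9` to `R + 2, …, R + 7`, reverses the messages in `3` and `4` to
`R + 8` and `R + 9`, and writes the template that samples one of the two messages, with nothing
revealed by `h` and everything by `f`. The message length is in register `R`. -/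
def pairTemplate (R : ℕ) : Prog :=
  .block [.copy (R + 2) 3, .copy (R + 3) 5, .copy (R + 4) 6, .copy (R + 5) 7, .copy (R + 6) 8,
    .copy (R + 7) 9,
    .copy (R + 10) 3, transfer R (R + 10) (R + 8), .copy (R + 11) 4,
    transfer R (R + 11) (R + 9), .copy (R + 12) (R + 8), .copy (R + 13) (R + 9),
    .copy 3 (R + 1), .push 3 true, .copy 4 (R + 1),
    pushList 4 [true, false, true, false, true, false, true, false],
    .copy 5 (R + 1), .loop R (selStep (R + 12) (R + 13) 5),
    .copy 6 (R + 1), .copy 7 (R + 1), .copy 8 (R + 1), .copy 9 (R + 1),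
    .loop R (countStep R (R + 14) (R + 15) 9)]

theorem pairTemplate_isDeterministic (R : ℕ) : IsDeterministic (pairTemplate R) := by
  rw [pairTemplate, isDeterministic_block]
  simp [IsDeterministic, transfer, copyTop, selStep, countStep, pushList_isDeterministic]

theorem pairTemplate_isPolyTime {R : ℕ} (hR : 10 ≤ R) : IsPolyTime (pairTemplate R) := by
  refine Steady.isPolyTime (R := {R}) ?_
  rw [pairTemplate, steady_block]
  simp only [List.forall_mem_cons, Steady, transfer, copyTop, selStep, countStep,
    Set.mem_singleton_iff, List.not_mem_nil, false_imp_iff, implies_true, and_true, true_and]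
  have h (r : ℕ) (hr : r ≠ R) (l : List Bool) : Steady {R} (pushList r l) :=
    pushList_steady (by simpa using hr) l
  simp (disch := omega) only [h, true_and, and_true]
  omega

theorem run_pairTemplate {R ℓ : ℕ} (hR : 10 ≤ R) (g : ℕ → List Bool) (hL : g R = unary ℓ)
    (h1 : g (R + 1) = []) (h8 : g (R + 8) = []) (h9 : g (R + 9) = []) (h14 : g (R + 14) = []) :
    let g' := run (pairTemplate R) g
    g' 3 = [true] ∧ g' 4 = [true, false, true, false, true, false, true, false] ∧
    (∀ β : Bool, (unaryBlocks 0 (g' 5)).map (fun i => [!β, true, β].getD i false) =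
      List.ofFn (readBits ℓ (g (if β then 4 else 3)))) ∧
    g' 7 = [] ∧ g' 8 = [] ∧ unaryBlocks 0 (g' 9) = (List.range ℓ).reverse ∧
    (g' (R + 2) = g 3 ∧ g' (R + 3) = g 5 ∧ g' (R + 4) = g 6 ∧ g' (R + 5) = g 7 ∧
      g' (R + 6) = g 8 ∧ g' (R + 7) = g 9) ∧
    g' (R + 8) = (List.ofFn (readBits ℓ (g 3))).reverse ∧
    g' (R + 9) = (List.ofFn (readBits ℓ (g 4))).reverse ∧
    ∀ r < R, r < 3 ∨ 9 < r → g' r = g r := by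
  intro g'
  have hlen : (unary ℓ).length = ℓ := by simp [unary]
  have hg' : g' = run (pairTemplate R) g := rfl
  simp only [pairTemplate, run_block_cons, run_block_nil] at hg'
  set g7 := run (.copy (R + 10) 3) (run (.copy (R + 7) 9) (run (.copy (R + 6) 8)
    (run (.copy (R + 5) 7) (run (.copy (R + 4) 6) (run (.copy (R + 3) 5)
    (run (.copy (R + 2) 3) g)))))) with hg7
  have k7 (r : ℕ) (h : r < R + 2 ∨ R + 10 < r ∨ r = R + 8 ∨ r = R + 9) : g7 r = g r := by
    simp (disch := omega) only [hg7, run_copy, Function.update_of_ne]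
  have s7 : g7 (R + 2) = g 3 ∧ g7 (R + 3) = g 5 ∧ g7 (R + 4) = g 6 ∧ g7 (R + 5) = g 7 ∧
      g7 (R + 6) = g 8 ∧ g7 (R + 7) = g 9 ∧ g7 (R + 10) = g 3 := by
    simp (disch := omega) only [hg7, run_copy, Function.update_of_ne, Function.update_self,
      and_self]
  obtain ⟨s72, s73, s74, s75, s76, s77, s710⟩ := s7
  set g8 := run (transfer R (R + 10) (R + 8)) g7 with hg8
  have k8 (r : ℕ) (h : r ≠ R + 10) (h' : r ≠ R + 8) : g8 r = g7 r :=
    run_transfer_of_ne h h' g7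
  have v8 : g8 (R + 8) = (List.ofFn (readBits ℓ (g 3))).reverse := by
    rw [hg8, run_transfer _ (by omega), k7 R (by omega), k7 (R + 8) (by omega), s710, hL, h8,
      hlen, List.append_nil]
  set g9 := run (.copy (R + 11) 4) g8 with hg9
  have k9 (r : ℕ) (h : r ≠ R + 11) : g9 r = g8 r := Function.update_of_ne h _ _
  have v9 : g9 (R + 11) = g 4 := by
    rw [hg9, run_copy, Function.update_self, k8 4 (by omega) (by omega), k7 4 (by omega)]
  set g10 := run (transfer R (R + 11) (R + 9)) g9 with hg10
  have k10 (r : ℕ) (h : r ≠ R + 11) (h' : r ≠ R + 9) : g10 r = g9 r :=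
    run_transfer_of_ne h h' g9
  have v10 : g10 (R + 9) = (List.ofFn (readBits ℓ (g 4))).reverse := by
    rw [hg10, run_transfer _ (by omega), k9 R (by omega), k8 R (by omega) (by omega),
      k7 R (by omega), k9 (R + 9) (by omega), k8 (R + 9) (by omega) (by omega),
      k7 (R + 9) (by omega), v9, hL, h9, hlen, List.append_nil]
  set g16 := run (.copy 5 (R + 1)) (run (pushList 4 [true, false, true, false, true, false, true,
    false]) (run (.copy 4 (R + 1)) (run (.push 3 true) (run (.copy 3 (R + 1))
    (run (.copy (R + 13) (R + 9)) (run (.copy (R + 12) (R + 8)) g10)))))) with hg16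
  have k16 (r : ℕ) (h : r < 3 ∨ 5 < r) (h' : r ≠ R + 12) (h'' : r ≠ R + 13) :
      g16 r = g10 r := by
    simp (disch := omega) only [hg16, run_pushList, run, Function.update_of_ne]
  have e10 : g10 (R + 1) = [] := by simp (disch := omega) only [k10, k9, k8, k7, h1]
  have v16 : g16 3 = [true] ∧ g16 4 = [true, false, true, false, true, false, true, false] ∧
      g16 5 = [] := by
    simp (disch := omega) [hg16, run_pushList, run, Function.update_of_ne, e10]
  obtain ⟨v163, v164, v165⟩ := v16
  have v1612 : g16 (R + 12) = (List.ofFn (readBits ℓ (g 3))).reverse := by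
    rw [← v8, ← k9 _ (by omega), ← k10 _ (by omega) (by omega)]
    simp (disch := omega) only [hg16, run_pushList, run, Function.update_of_ne,
      Function.update_self]
  have v1613 : g16 (R + 13) = (List.ofFn (readBits ℓ (g 4))).reverse := by
    rw [← v10]
    simp (disch := omega) only [hg16, run_pushList, run, Function.update_of_ne,
      Function.update_self]
  set g17 := run (.loop R (selStep (R + 12) (R + 13) 5)) g16 with hg17
  have k17 (r : ℕ) (h : r ≠ 5) (h' : r ≠ R + 12) (h'' : r ≠ R + 13) : g17 r = g16 r := by
    refine Keeps.run_eq ?_ g16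
    simp only [Keeps, selStep, pushList_keeps h, h', h'', ne_eq, not_false_eq_true,
      and_true]
  have L16 : g16 R = unary ℓ := by simp (disch := omega) only [k16, k10, k9, k8, k7, hL]
  have v17 (β : Bool) : (unaryBlocks 0 (g17 5)).map (fun i => [!β, true, β].getD i false) =
      List.ofFn (readBits ℓ (g (if β then 4 else 3))) := by
    have := run_selStep_iterate (a := R + 12) (b := R + 13) (o := 5) (by omega) (by omega)
      (by omega) β (List.ofFn (readBits ℓ (g 3))).reverse
      (List.ofFn (readBits ℓ (g 4))).reverse g16 (by simp) v1612 v1613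
    rw [v165, List.length_reverse, List.length_ofFn] at this
    rw [hg17, run, L16, hlen, this]
    cases β <;> simp [unaryBlocks]
  set g21 := run (.copy 9 (R + 1)) (run (.copy 8 (R + 1)) (run (.copy 7 (R + 1))
    (run (.copy 6 (R + 1)) g17))) with hg21
  have k21 (r : ℕ) (h : r < 6 ∨ 9 < r) : g21 r = g17 r := by
    simp (disch := omega) only [hg21, run_copy, Function.update_of_ne]
  have e17 : g17 (R + 1) = [] := by
    simp (disch := omega) only [k17, k16, e10]
  have v21 : g21 7 = [] ∧ g21 8 = [] ∧ g21 9 = [] := by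
    simp (disch := omega) only [hg21, run_copy, Function.update_of_ne, Function.update_self, e17,
      and_self]
  have k22 (r : ℕ) (h : r ≠ 9) (h' : r ≠ R + 14) (h'' : r ≠ R + 15) : g' r = g21 r := by
    rw [hg']
    refine Keeps.run_eq ?_ g21
    simp only [Keeps, countStep, h, h', h'', ne_eq, not_false_eq_true, and_self]
  have v22 : unaryBlocks 0 (g' 9) = (List.range ℓ).reverse := by
    have L21 : g21 R = unary ℓ := by simp (disch := omega) only [k21, k17, L16]
    rw [hg', run, L21, hlen, run_countStep_iterate (by omega) (by omega) (by omega) (by omega)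
      (by omega) (by omega) ℓ 0 g21, v21.2.2]
    · simp [unaryBlocks, List.range_eq_range']
    · rw [L21, hlen, zero_add]
    · simp (disch := omega) only [k21, k17, k16, k10, k9, k8, k7, h14, List.replicate_zero]
  refine ⟨?_, ?_, fun β => ?_, ?_, ?_, v22, ⟨?_, ?_, ?_, ?_, ?_, ?_⟩, ?_, ?_, fun r hr hr' => ?_⟩
  · simp (disch := omega) only [k22, k21, k17, v163]
  · simp (disch := omega) only [k22, k21, k17, v164]
  · rw [k22 5 (by omega) (by omega) (by omega), k21 5 (by omega), v17]
  · rw [k22 7 (by omega) (by omega) (by omega), v21.1]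
  · rw [k22 8 (by omega) (by omega) (by omega), v21.2.1]
  all_goals simp (disch := omega) only [k22, k21, k17, k16, k10, k9, k8, k7, s72, s73, s74, s75,
    s76, s77, v8, v10]

/-! ### Expectations -/

/-- The expectation of a nonnegative function. -/
def expect {α : Type} (p : PMF α) (f : α → ℝ≥0∞) : ℝ≥0∞ := ∑' a, p a * f a

theorem bind_apply_eq_expect {α β : Type} (p : PMF α) (q : α → PMF β) (b : β) :
    (p.bind q) b = expect p fun a => q a b := PMF.bind_apply _ _ _

theorem expect_bind {α β : Type} (p : PMF α) (q : α → PMF β) (f : β → ℝ≥0∞) :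
    expect (p.bind q) f = expect p fun a => expect (q a) f := by
  simp only [expect, PMF.bind_apply, ← ENNReal.tsum_mul_right, ← ENNReal.tsum_mul_left]
  rw [ENNReal.tsum_comm]
  simp only [mul_assoc]

theorem expect_pure {α : Type} (a : α) (f : α → ℝ≥0∞) : expect (PMF.pure a) f = f a := by
  rw [expect, tsum_eq_single a]
  · simp
  · intro b hb
    simp [PMF.pure_apply, hb]

theorem expect_map {α β : Type} (p : PMF α) (g : α → β) (f : β → ℝ≥0∞) :
    expect (p.map g) f = expect p fun a => f (g a) := by
  rw [← PMF.bind_pure_comp, expect_bind]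
  simp only [Function.comp_apply, expect_pure]

theorem expect_mono {α : Type} (p : PMF α) {f g : α → ℝ≥0∞} (h : ∀ a, f a ≤ g a) :
    expect p f ≤ expect p g :=
  ENNReal.tsum_le_tsum fun a => mul_le_mul_right (h a) _

theorem expect_const {α : Type} (p : PMF α) (x : ℝ≥0∞) : expect p (fun _ => x) = x := by
  rw [expect, ENNReal.tsum_mul_right, p.tsum_coe, one_mul]

theorem expect_add {α : Type} (p : PMF α) (f g : α → ℝ≥0∞) :
    expect p (fun a => f a + g a) = expect p f + expect p g := by
  simp only [expect, mul_add, ENNReal.tsum_add]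

/-! ### The best guess without a ciphertext -/

theorem map_beq_apply_true {α β : Type} [BEq β] [LawfulBEq β] (p : PMF α) (F : α → β) (s : β) :
    p.map (fun a => s == F a) true = p.map F s := by
  rw [PMF.map_apply, PMF.map_apply]
  congr 1
  funext a
  by_cases h : s = F a <;> simp [h]

/-- The best probability with which `f(m)` can be guessed given the template, if `h` reveals
nothing. -/
def guessProb (ℓ : ℕ) (τ : Template) : ℝ≥0∞ :=
  open Classical in
  if ∀ x, τ.h.eval x = [] then
    ⨆ s, ((τ.msgDist ℓ).map fun m => τ.f.eval (List.ofFn m)) s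
  else 1

/-- If `h` is constantly empty, the second phase starts from a memory that does not depend on `m`.
Its output can then be fixed before `m` is drawn, and a fixed string equals `f(m)` with probability
at most the largest point mass. If `h` is not, the bound is the trivial one. -/
theorem semGame_false_le (Sch : SKES) (S : QPT) (n : ℕ) :
    semGame Sch S false n true ≤ expect (templateDist Sch S n) (guessProb (Sch.msgLen n)) := by
  rw [semGame, templateDist, expect_bind, bind_apply_eq_expect]
  refine expect_mono _ fun k => ?_
  rw [expect_map, bind_apply_eq_expect]
  refine expect_mono _ fun c => ?_
  by_cases h : ∀ x, (readTemplate c).h.eval x = []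
  · rw [guessProb, if_pos h]
    simp only [h, PMF.bind_const, Bool.false_eq_true, if_false]
    simp only [← PMF.bind_pure_comp]
    -- The plaintext is now drawn after the output `c₂`.
    rw [PMF.bind_comm, bind_apply_eq_expect]
    refine (expect_mono _ fun c₂ => ?_).trans_eq (expect_const _ _)
    refine le_trans (le_of_eq ?_) (le_iSup _ (c₂.reg 5))
    exact map_beq_apply_true _ _ _
  · rw [guessProb, if_neg h]
    exact PMF.coe_le_one _ _

theorem msgDist_of_coins_eq_one (ℓ : ℕ) (τ : Template) (h : τ.coins = 1) :
    τ.msgDist ℓ = (PMF.uniformOfFintype Bool).map fun β => readBits ℓ (τ.samp.eval [β]) := by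
  obtain ⟨c, s, h', f⟩ := τ
  subst h
  rw [Template.msgDist, bits_uniform_succ, PMF.map_bind, ← PMF.bind_pure_comp]
  congr 1
  funext β
  rw [PMF.map_comp]
  have : (fun r : Bits 1 => readBits ℓ (s.eval (List.ofFn r))) ∘
      (fun v : Bits 0 => (Fin.snoc v β : Bits 1)) =
      Function.const _ (readBits ℓ (s.eval [β])) := by
    funext v
    simp [Fin.snoc]
  exact (congrArg (PMF.map · _) this).trans (PMF.map_const _ _)

/-! ### The reduction from indistinguishability to semantic security -/

/-- Writes the saved registers back. -/
def restore (R : ℕ) : Prog :=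
  .block [.copy 3 (R + 2), .copy 5 (R + 3), .copy 6 (R + 4), .copy 7 (R + 5), .copy 8 (R + 6),
    .copy 9 (R + 7)]

/-- The adversary against semantic security obtained from a distinguisher. Its plaintext is one of
the two challenge messages, and it outputs the one that the distinguisher guesses (reversed). -/
def indAdversary (A : QPT) : QPT where
  pre := .seq (.copy A.bound 1) (.seq A.pre (pairTemplate A.bound))
  post := .seq (restore A.bound) (.seq A.post
    (.branch 5 (.copy 5 (A.bound + 8)) (.copy 5 (A.bound + 8)) (.copy 5 (A.bound + 9))))
  pre_poly := (copy_isPolyTime _ _).seq (A.pre_poly.seq (pairTemplate_isPolyTime A.ten_le_bound))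
  post_poly := by
    refine IsPolyTime.seq ?_ (A.post_poly.seq ?_)
    · refine isPolyTime_block ?_
      simp only [List.forall_mem_cons, copy_isPolyTime, true_and, List.not_mem_nil, false_imp_iff,
        implies_true]
    · exact Steady.isPolyTime (R := ∅) (by simp [Steady])

/-- The challenge message for the bit `β`. -/
def challenge (Sch : SKES) (n : ℕ) (c : Config) (β : Bool) : Bits (Sch.msgLen n) :=
  readBits (Sch.msgLen n) (c.reg (if β then 4 else 3))

theorem exec_indAdversary_pre (Sch : SKES) (A : QPT) (n : ℕ) (k : Bits (Sch.keyLen n)) :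
    ∃ F : Config → Config,
      exec (Sch.preOracles n k) (indAdversary A).pre (Sch.start n) =
        (exec (Sch.preOracles n k) A.pre (Sch.start n)).map F ∧
      ∀ c, (F c).qst = c.qst ∧
        (readTemplate (F c)).coins = 1 ∧
        (∀ β, readBits (Sch.msgLen n) ((readTemplate (F c)).samp.eval [β]) =
          challenge Sch n c β) ∧
        (∀ x, (readTemplate (F c)).h.eval x = []) ∧
        (∀ m : Bits (Sch.msgLen n),
          (readTemplate (F c)).f.eval (List.ofFn m) = (List.ofFn m).reverse) ∧
        ((F c).reg (A.bound + 2) = c.reg 3 ∧ (F c).reg (A.bound + 3) = c.reg 5 ∧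
          (F c).reg (A.bound + 4) = c.reg 6 ∧ (F c).reg (A.bound + 5) = c.reg 7 ∧
          (F c).reg (A.bound + 6) = c.reg 8 ∧ (F c).reg (A.bound + 7) = c.reg 9) ∧
        (F c).reg (A.bound + 8) = (List.ofFn (challenge Sch n c false)).reverse ∧
        (F c).reg (A.bound + 9) = (List.ofFn (challenge Sch n c true)).reverse ∧
        ∀ r < A.bound, r < 3 ∨ 9 < r → (F c).reg r = c.reg r := by
  have h10 := A.ten_le_bound
  set c0 := (Sch.start n).set A.bound (unary (Sch.msgLen n)) with hc0
  refine ⟨fun c => ⟨run (pairTemplate A.bound) (graft A.bound c0.reg c).reg, c.qst⟩, ?_,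
    fun c => ?_⟩
  · simp only [indAdversary, exec_seq, exec_copy, PMF.pure_bind, start_reg_one]
    rw [exec_of_agree (c := Sch.start n) (d := c0) _ A.pre_le_bound, PMF.bind_map,
      ← PMF.bind_pure_comp]
    · congr 1
      funext c
      rw [Function.comp_apply, exec_eq_run _ (pairTemplate_isDeterministic _)]
      rfl
    · rfl
    · intro r hr
      simp (disch := omega) only [hc0, Config.set, Function.update_of_ne]
  · beta_reduce
    set d := graft A.bound c0.reg c with hd
    have hlt (x : ℕ) (hx : x < A.bound) : d.reg x = c.reg x := graft_reg_lt _ _ hx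
    have hge (x : ℕ) (hx : A.bound < x) : d.reg x = [] := by
      simp (disch := omega) only [hd, Config.set, Function.update_of_ne, graft_reg_ge, hc0,
        start_reg_of_two_lt]
    have hL : d.reg A.bound = unary (Sch.msgLen n) := by
      rw [hd, graft_reg_ge _ _ le_rfl, hc0]
      simp only [Config.set, Function.update_self]
    obtain ⟨e3, e4, e5, e7, e8, e9, es, ea, eb, ek⟩ := run_pairTemplate h10 d.reg hL
      (hge _ (by omega)) (hge _ (by omega)) (hge _ (by omega)) (hge _ (by omega))
    have hβ (β : Bool) : d.reg (if β then 4 else 3) = c.reg (if β then 4 else 3) :=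
      hlt _ (by split_ifs <;> omega)
    refine ⟨rfl, ?_, fun β => ?_, fun x => ?_, fun m => ?_, ?_, ?_, ?_, fun r hr hr' => ?_⟩
    · simp [readTemplate, e3]
    · have hs := e5 β
      rw [hβ] at hs
      -- The code stands for the gate `(1, 1)` twice. The first reads the missing wire 1, which is
      -- 0, and gives the constant 1; the second then finds `β` as wire 1 and negates it.
      have hw : (decodeCircuit [true, false, true, false, true, false, true, false] []).gates.foldl
          (fun (w : List Bool) (g : ℕ × ℕ) =>
            (!(w.getD g.1 false && w.getD g.2 false)) :: w) [β] = [!β, true, β] := by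
        cases β <;> rfl
      simp only [decodeCircuit] at hw
      simp only [readTemplate, Circuit.eval, decodeCircuit, e4, hw, hs, challenge]
      have := ofFn_readBits_length
        (List.ofFn (readBits (Sch.msgLen n) (c.reg (if β then 4 else 3))))
      rw [List.length_ofFn] at this
      exact List.ofFn_injective this
    · simp [readTemplate, Circuit.eval, decodeCircuit, e7, unaryBlocks]
    · simp only [readTemplate, Circuit.eval, decodeCircuit, e8, e9, unaryBlocks, pairUp,
        List.foldl_nil, List.map_reverse]
      congr 1
      apply List.ext_getElem
      · simp
      · intro i hi _
        simp at hi
        simp [hi]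
    · rw [hlt 3 (by omega), hlt 5 (by omega), hlt 6 (by omega), hlt 7 (by omega),
        hlt 8 (by omega), hlt 9 (by omega)] at es
      exact es
    · rw [hlt 3 (by omega)] at ea
      exact ea
    · rw [hlt 4 (by omega)] at eb
      exact eb
    · exact (ek r hr hr').trans (hlt r hr)

/-- Restoring registers 3 and 5 to 9 undoes the template, after which `A` continues as in its own
game. Register 4 needs no saving, because both games overwrite it with the challenge ciphertext. -/
theorem exec_indAdversary_post (Sch : SKES) (A : QPT) (n : ℕ)
    (k : Bits (Sch.keyLen n)) {c d : Config} (u x : List Bool) (y z : List Bool)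
    (hq : d.qst = c.qst)
    (hs : d.reg (A.bound + 2) = c.reg 3 ∧ d.reg (A.bound + 3) = c.reg 5 ∧
      d.reg (A.bound + 4) = c.reg 6 ∧ d.reg (A.bound + 5) = c.reg 7 ∧
      d.reg (A.bound + 6) = c.reg 8 ∧ d.reg (A.bound + 7) = c.reg 9)
    (h8 : d.reg (A.bound + 8) = y) (h9 : d.reg (A.bound + 9) = z)
    (hlt : ∀ r < A.bound, r < 3 ∨ 9 < r → d.reg r = c.reg r) :
    ((exec (Sch.postOracles n k) (indAdversary A).post
      (((Sch.writeParams n d).set 3 u).set 4 x)).map fun c₂ => c₂.reg 5) =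
      (exec (Sch.postOracles n k) A.post ((Sch.writeParams n c).set 4 x)).map fun c₂ =>
        if (c₂.reg 5).headD false then z else y := by
  have h10 := A.ten_le_bound
  have hdet (c₁ : Config) : exec (Sch.postOracles n k) (.branch 5 (.copy 5 (A.bound + 8))
      (.copy 5 (A.bound + 8)) (.copy 5 (A.bound + 9))) c₁ = _ :=
    exec_eq_run _ (by simp [IsDeterministic]) c₁
  have hdet' (c₁ : Config) : exec (Sch.postOracles n k) (restore A.bound) c₁ = _ :=
    exec_eq_run _ (by simp [IsDeterministic, restore, isDeterministic_block]) c₁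
  simp only [indAdversary, exec_seq, hdet, hdet', PMF.pure_bind, PMF.map_bind, PMF.pure_map]
  obtain ⟨hs2, hs3, hs4, hs5, hs6, hs7⟩ := hs
  have hbig (r : ℕ) (hr : 9 < r) : run (restore A.bound)
      (((Sch.writeParams n d).set 3 u).set 4 x).reg r = d.reg r := by
    simp (disch := omega) only [restore, run_block_cons, run_block_nil, run_copy, Config.set,
      Function.update_of_ne, writeParams_reg_of_two_lt]
  rw [← Function.comp_def PMF.pure, PMF.bind_pure_comp]
  refine map_exec_of_agree _ A.post_le_bound ?_ ?_ fun c₂ => ?_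
  · exact hq
  · intro r hr
    by_cases h9 : r < 3 ∨ 9 < r
    · simp (disch := omega) only [restore, run_block_cons, run_block_nil, run_copy, Config.set,
        Function.update_of_ne]
      exact writeParams_reg_congr _ _ (hlt r hr h9)
    · have hw (x : ℕ) (hx : 2 < x) := writeParams_reg_of_two_lt Sch n c hx
      have hw' (x : ℕ) (hx : 2 < x) := writeParams_reg_of_two_lt Sch n d hx
      obtain ⟨ha, hb⟩ : 3 ≤ r ∧ r ≤ 9 := by omega
      interval_cases r <;>
        simp (disch := omega) only [restore, run_block_cons, run_block_nil, run_copy, Config.set,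
          Function.update_of_ne, Function.update_self, hw, hw', hs2, hs3, hs4, hs5, hs6, hs7]
  · set e := graft A.bound (run (restore A.bound)
      (((Sch.writeParams n d).set 3 u).set 4 x).reg) c₂ with he
    have e5 : e.reg 5 = c₂.reg 5 := graft_reg_lt _ _ (by omega)
    have e8 : e.reg (A.bound + 8) = y := by
      rw [he, graft_reg_ge _ _ (by omega), hbig _ (by omega), h8]
    have e9 : e.reg (A.bound + 9) = z := by
      rw [he, graft_reg_ge _ _ (by omega), hbig _ (by omega), h9]
    change run _ e.reg 5 = _
    rcases h : c₂.reg 5 with _ | ⟨_ | _, _⟩ <;> rw [h] at e5 <;> simp [run, e5, e8, e9]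

/-- The second phase of the indistinguishability game, with guess as the result. -/
def indPhase (Sch : SKES) (A : QPT) (n : ℕ) (k : Bits (Sch.keyLen n)) (c : Config)
    (m : Bits (Sch.msgLen n)) : PMF Bool :=
  (Sch.encDist n k m).bind fun ct =>
  (exec (Sch.postOracles n k) A.post ((Sch.writeParams n c).set 4 (List.ofFn ct))).map fun c₂ =>
  (c₂.reg 5).headD false

theorem indGame_eq (Sch : SKES) (A : QPT) (n : ℕ) :
    indGame Sch A n = (Sch.keyDist n).bind fun k =>
      (exec (Sch.preOracles n k) A.pre (Sch.start n)).bind fun c =>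
      (PMF.uniformOfFintype Bool).bind fun β =>
      (indPhase Sch A n k c (challenge Sch n c β)).map fun v => v == β := by
  rw [indGame]
  congr 1
  funext k
  rw [PMF.bind_comm]
  simp only [indPhase, PMF.map_bind, PMF.map_comp]
  rfl

/-- The coin of the template plays the role of the hidden bit. The only difference from `indGame_eq`
is that messages instead of bits are compared, which matters only if the challenge messages
coincide. -/
theorem semGame_indAdversary (Sch : SKES) (A : QPT) (n : ℕ) :
    semGame Sch (indAdversary A) true n = (Sch.keyDist n).bind fun k =>
      (exec (Sch.preOracles n k) A.pre (Sch.start n)).bind fun c =>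
      (PMF.uniformOfFintype Bool).bind fun β =>
      (indPhase Sch A n k c (challenge Sch n c β)).map fun v =>
        challenge Sch n c v == challenge Sch n c β := by
  rw [semGame]
  congr 1
  funext k
  obtain ⟨F, hF, hprop⟩ := exec_indAdversary_pre Sch A n k
  rw [hF, PMF.bind_map]
  congr 1
  funext c
  obtain ⟨p1, p2, p3, p4, p5, p6, p7, p8, p9⟩ := hprop c
  rw [Function.comp_apply, msgDist_of_coins_eq_one _ _ p2, PMF.bind_map]
  congr 1
  funext β
  rw [Function.comp_apply, p3, indPhase, PMF.map_bind]
  congr 1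
  funext ct
  rw [if_pos rfl, PMF.map_comp, p5]
  have := exec_indAdversary_post Sch A n k
    ((readTemplate (F c)).h.eval (List.ofFn (challenge Sch n c β))) (List.ofFn ct) _ _ p1 p6 p7 p8 p9
  have := congrArg (PMF.map (· == (List.ofFn (challenge Sch n c β)).reverse)) this
  rw [PMF.map_comp, PMF.map_comp] at this
  refine this.trans ?_
  congr 1
  funext c₂
  simp only [Function.comp_apply]
  have hif (v : Bool) : (if v then (List.ofFn (challenge Sch n c true)).reverse
      else (List.ofFn (challenge Sch n c false)).reverse) =
      (List.ofFn (challenge Sch n c v)).reverse := by cases v <;> rfl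
  rw [hif, Bool.eq_iff_iff]
  simp only [beq_iff_eq, List.reverse_inj]
  exact List.ofFn_injective.eq_iff

/-- For distinct challenge messages, the injective `f` turns the coin into two different strings of
probability 1/2 each. -/
theorem expect_guessProb_indAdversary_le (Sch : SKES) (A : QPT) (n : ℕ) :
    expect (templateDist Sch (indAdversary A) n) (guessProb (Sch.msgLen n)) ≤
      expect (Sch.keyDist n) fun k =>
        expect (exec (Sch.preOracles n k) A.pre (Sch.start n)) fun c =>
          if challenge Sch n c false = challenge Sch n c true then 1 else 2⁻¹ := by
  rw [templateDist, expect_bind]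
  refine expect_mono _ fun k => ?_
  obtain ⟨F, hF, hprop⟩ := exec_indAdversary_pre Sch A n k
  rw [hF, expect_map, expect_map]
  refine expect_mono _ fun c => ?_
  obtain ⟨-, p2, p3, p4, p5, -⟩ := hprop c
  rw [guessProb, if_pos p4]
  refine iSup_le fun s => ?_
  split_ifs with h
  · exact PMF.coe_le_one _ _
  · rw [msgDist_of_coins_eq_one _ _ p2, PMF.map_comp, ← PMF.bind_pure_comp, uniform_bool_bind]
    simp only [Function.comp_apply, p3, p5, PMF.pure_apply]
    by_cases h1 : s = (List.ofFn (challenge Sch n c true)).reverse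
    · rw [if_pos h1, if_neg, mul_one, mul_zero, add_zero]
      intro h2
      exact h (List.ofFn_injective (List.reverse_injective (h2.symm.trans h1)))
    · rw [if_neg h1, mul_zero, zero_add]
      exact mul_le_of_le_one_right' (by split_ifs <;> simp)

theorem semqcca1_indqcca1 {Sch : SKES} (h : SEMQCCA1 Sch) : INDQCCA1 Sch := by
  intro A
  obtain ⟨S, hS, μ, hμ, hdiff⟩ := h (indAdversary A)
  refine ⟨μ, hμ, fun n => ?_⟩
  set U := expect (Sch.keyDist n) fun k =>
    expect (exec (Sch.preOracles n k) A.pre (Sch.start n)) fun c =>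
      if challenge Sch n c false = challenge Sch n c true then (1 : ℝ≥0∞) else 2⁻¹ with hU
  have hSU : semGame Sch S false n true ≤ U := by
    refine (semGame_false_le Sch S n).trans ?_
    rw [← hS n]
    exact expect_guessProb_indAdversary_le Sch A n
  -- The identity holds for each key and each outcome of the first phase. With equal challenge
  -- messages it reads `1 + 1/2 = 1/2 + 1`, as every guess names the right message but the bit is
  -- hidden perfectly; with distinct ones the two winning events coincide. Writing it with sums
  -- avoids truncated subtraction.
  have hsum : semGame Sch (indAdversary A) true n true + 2⁻¹ = indGame Sch A n true + U := by
    have hhalf : (2⁻¹ : ℝ≥0∞) = expect (Sch.keyDist n) fun k =>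
        expect (exec (Sch.preOracles n k) A.pre (Sch.start n)) fun _ => 2⁻¹ := by
      simp only [expect_const]
    rw [semGame_indAdversary, indGame_eq, hhalf, hU, bind_apply_eq_expect, bind_apply_eq_expect,
      ← expect_add, ← expect_add]
    congr 1
    funext k
    rw [bind_apply_eq_expect, bind_apply_eq_expect, ← expect_add, ← expect_add]
    congr 1
    funext c
    split_ifs with hc
    · have hall (v : Bool) : challenge Sch n c v = challenge Sch n c true := by
        cases v
        · exact hc
        · rfl
      have h1 (p : PMF Bool) : p.map (fun _ => true) true = 1 := by
        rw [show p.map (fun _ => true) = PMF.pure true from PMF.map_const _ _]; simp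
      have h2 (p : PMF Bool) : 2⁻¹ * p.map (fun v => v == true) true +
          2⁻¹ * p.map (fun v => v == false) true = 2⁻¹ := by
        have ht := p.tsum_coe
        rw [tsum_fintype, Fintype.sum_bool] at ht
        have hid : p.map (fun v => v) = p := PMF.map_id p
        simp only [beq_true, beq_false, pmf_map_not, hid]
        rw [← mul_add, ht, mul_one]
      rw [uniform_bool_bind, uniform_bool_bind]
      simp only [hall, beq_self_eq_true, h1, h2, mul_one, ENNReal.inv_two_add_inv_two]
      exact add_comm _ _
    · congr 1
      congr 1
      congr 1
      funext β
      congr 1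
      funext v
      rw [Bool.eq_iff_iff]
      cases v <;> cases β <;> simp [hc, Ne.symm hc]
  have hUtop : U ≠ ⊤ := by
    intro hU'
    rw [hU', add_top] at hsum
    exact ENNReal.add_ne_top.2 ⟨PMF.apply_ne_top _ _, by simp⟩ hsum
  have h1 := ENNReal.toReal_mono hUtop hSU
  have h2 := congrArg ENNReal.toReal hsum
  rw [ENNReal.toReal_add (PMF.apply_ne_top _ _) (by simp),
    ENNReal.toReal_add (PMF.apply_ne_top _ _) hUtop] at h2
  have h3 := (abs_le.1 (hdiff n)).2
  simp only [ENNReal.toReal_inv, ENNReal.toReal_ofNat] at h2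
  linarith

end QCrypt

end

theorem mainTheorem6 (Sch : QCrypt.SKES) : QCrypt.INDQCCA1 Sch ↔ QCrypt.SEMQCCA1 Sch :=
  ⟨QCrypt.indqcca1_semqcca1, QCrypt.semqcca1_indqcca1⟩
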